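/- Let $M$ be a smooth manifold of dimension $n>2$ with an equiprojective equiaffine $SL(n,\mathbb R)$-structure $(\eta,\nabla)$. That is, $\nabla$ is a smooth torsion-free linear connection on $M$, $\eta$ is a smooth nowhere vanishing $n$-form with $\nabla\eta=0$, and the Weyl projective curvature tensor of $\nabla$ vanishes: for all vector fields $X,Y,Z$ $$R(X,Y)Z=\frac{1}{n-1}\bigl(\mathrm{Ric}(Y,Z)X-\mathrm{Ric}(X,Z)Y\bigr),\qquad \mathrm{Ric}(Y,Z)=\mathrm{trace}\,\bigl(X\mapsto R(X,Y)Z\bigr).$$ A Killing–Yano tensor of degree $p$ on an open set $U\subseteq M$ is a smooth $p$-form $\omega$ on $U$ whose covariant derivative $\nabla\omega$ is totally skew-symmetric. Then every point of $M$ has an open neighbourhood $U$ with smooth coordinates $x^1,\dots,x^n$ on $U$ such that the component $\eta_{1\dots n}=\eta(\partial_1,\dots,\partial_n)$ is positive on $U$ and, with $\psi=(n+1)^{-1}\ln\eta_{1\dots n}$, the following holds for every $p$ with $1\le p\le n-1$. (a) For every Killing–Yano tensor $\omega$ of degree $p$ on $U$ (in particular, for the restriction to $U$ of every Killing–Yano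 tensor of degree $p$ on $M$) there are real constants $A_{i_0i_1\dots i_p}$ and $B_{i_1\dots i_p}$, skew-symmetric with respect to all their indices, such that on $U$ $$\omega_{i_1\dots i_p}=e^{(p+1)\psi}\Bigl(\sum_{i_0=1}^n A_{i_0i_1\dots i_p}\,x^{i_0}+B_{i_1\dots i_p}\Bigr)\qquad(1\le i_1,\dots,i_p\le n).$$ (b) Conversely, for arbitrary constants $A_{i_0i_1\dots i_p}$ and $B_{i_1\dots i_p}$, skew-symmetric with respect to all their indices, the $p$-form on $U$ with these components is a Killing–Yano tensor of degree $p$ on $U$. -/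

import Mathlib

open scoped Manifold ContDiff

noncomputable section

namespace Equiaffine

/-- The model space `ℝⁿ`; the standard coordinates of `y` are `y i`, `i : Fin n`. -/
abbrev Rn (n : ℕ) : Type := EuclideanSpace ℝ (Fin n)

section

variable {n : ℕ} {M : Type*} [TopologicalSpace M] [ChartedSpace (Rn n) M]

/-- The tangent space of `M` at `x`. -/
abbrev Tangent (n : ℕ) {M : Type*} [TopologicalSpace M] [ChartedSpace (Rn n) M] (x : M) : Type :=
  TangentSpace 𝓘(ℝ, Rn n) x

/-- A (not necessarily smooth) vector field on `M`. -/
abbrev VField (n : ℕ) (M : Type*) [TopologicalSpace M] [ChartedSpace (Rn n) M] : Type _ :=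
  (x : M) → Tangent n x

/-- A (not necessarily smooth) field of skew-symmetric covariant tensors of degree `p` on `M`. -/
abbrev FormField (n : ℕ) (M : Type*) [TopologicalSpace M] [ChartedSpace (Rn n) M] (p : ℕ) :
    Type _ :=
  (x : M) → Tangent n x [⋀^Fin p]→L[ℝ] ℝ

/-- The vector field `X` is smooth near `x`. -/
def SmoothFieldAt [IsManifold 𝓘(ℝ, Rn n) ∞ M] (X : VField n M) (x : M) : Prop :=
  ContMDiffAt 𝓘(ℝ, Rn n) (𝓘(ℝ, Rn n)).tangent ∞
    (fun y => (⟨y, X y⟩ : TangentBundle 𝓘(ℝ, Rn n) M)) x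

/-- The form `θ` is smooth on `U`: inserting smooth vector fields gives smooth functions. -/
def SmoothFormOn [IsManifold 𝓘(ℝ, Rn n) ∞ M] {p : ℕ} (θ : FormField n M p)
    (U : Set M) : Prop :=
  ∀ x ∈ U, ∀ Y : Fin p → VField n M, (∀ i, SmoothFieldAt (Y i) x) →
    ContMDiffAt 𝓘(ℝ, Rn n) 𝓘(ℝ, ℝ) ∞ (fun y => θ y (fun i => Y i y)) x

/-- A linear connection on `M` (a covariant derivative on the tangent bundle);
`cov Y x v` is `(∇_v Y)(x)`. -/
abbrev Connection (n : ℕ) (M : Type*) [TopologicalSpace M] [ChartedSpace (Rn n) M]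
    [IsManifold 𝓘(ℝ, Rn n) ∞ M] : Type _ :=
  CovariantDerivative 𝓘(ℝ, Rn n) (Rn n) (TangentSpace 𝓘(ℝ, Rn n) : M → Type)

variable [IsManifold 𝓘(ℝ, Rn n) ∞ M]

/-- The vector field `∇_X Y`. -/
def nabla (cov : Connection n M) (X Y : VField n M) : VField n M :=
  fun x => cov Y x (X x)

/-- The covariant derivative of a form evaluated on vector fields:
`(∇_X θ)(Y₁, …, Y_p) = X (θ(Y₁, …, Y_p)) - ∑ᵢ θ(Y₁, …, ∇_X Yᵢ, …, Y_p)` at the point `x`. -/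
def nablaForm (cov : Connection n M) {p : ℕ} (θ : FormField n M p) (X : VField n M)
    (Y : Fin p → VField n M) (x : M) : ℝ :=
  mvfderiv 𝓘(ℝ, Rn n) (fun y => θ y (fun i => Y i y)) x (X x)
    - ∑ i, θ x (Function.update (fun j => Y j x) i (nabla cov X (Y i) x))

/-- The curvature `R(X, Y)Z = ∇_X ∇_Y Z - ∇_Y ∇_X Z - ∇_[X,Y] Z`. -/
def curvature (cov : Connection n M) (X Y Z : VField n M) : VField n M :=
  nabla cov X (nabla cov Y Z) - nabla cov Y (nabla cov X Z)
    - nabla cov (VectorField.mlieBracket 𝓘(ℝ, Rn n) X Y) Z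

/-- A vector field smooth near `x` with value `v` at `x`. -/
def localExtend {x : M} (v : Tangent n x) : VField n M :=
  FiberBundle.extend (Rn n) v

/-- A basis `e₁, …, eₙ` of the tangent space at `x` (which is a copy of `ℝⁿ`). -/
def tangentBasis (n : ℕ) {M : Type*} [TopologicalSpace M] [ChartedSpace (Rn n) M] (x : M) :
    Module.Basis (Fin n) ℝ (Tangent n x) :=
  (EuclideanSpace.basisFun (Fin n) ℝ).toBasis

/-- The Ricci tensor `Ric(v, w)` at `x`: the trace of `u ↦ R(u, v)w` on the tangent space at `x`,
computed in a basis. -/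
def ricci (cov : Connection n M) (x : M) (v w : Tangent n x) : ℝ :=
  ∑ i : Fin n, (tangentBasis n x).coord i
    (curvature cov (localExtend (tangentBasis n x i)) (localExtend v) (localExtend w) x)

/-- `(η, ∇)` is an equiaffine structure: `∇` is a smooth torsion-free linear connection and `η` is
a volume element (a smooth nowhere vanishing `n`-form) which is parallel with respect to `∇`. -/
structure IsEquiaffine (η : FormField n M n) (cov : Connection n M) : Prop where
  smooth_connection : CovariantDerivative.ContMDiffCovariantDerivative cov ∞
  torsion_free : CovariantDerivative.torsion cov = 0
  smooth_volume : SmoothFormOn η Set.univ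
  volume_ne_zero : ∀ x, η x ≠ 0
  parallel : ∀ (x : M) (X : VField n M) (Y : Fin n → VField n M), SmoothFieldAt X x →
    (∀ i, SmoothFieldAt (Y i) x) → nablaForm cov η X Y x = 0

/-- `∇` is equiprojective, i.e. its Weyl projective curvature tensor vanishes:
`R(X, Y)Z = (n - 1)⁻¹ (Ric(Y, Z) X - Ric(X, Z) Y)`. -/
def IsEquiprojective (cov : Connection n M) : Prop :=
  ∀ (x : M) (X Y Z : VField n M), SmoothFieldAt X x → SmoothFieldAt Y x → SmoothFieldAt Z x →
    curvature cov X Y Z x =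
      ((n : ℝ) - 1)⁻¹ • (ricci cov x (Y x) (Z x) • X x - ricci cov x (X x) (Z x) • Y x)

/-- `θ` is a Killing-Yano tensor of degree `p` on `U`: it is a smooth `p`-form on `U`, and `∇θ` is
totally skew, i.e. at every point of `U` it is a `(p + 1)`-form. -/
def IsKillingYanoOn (cov : Connection n M) {p : ℕ} (θ : FormField n M p) (U : Set M) : Prop :=
  SmoothFormOn θ U ∧
    ∀ x ∈ U, ∃ α : Tangent n x [⋀^Fin (p + 1)]→L[ℝ] ℝ,
      ∀ Y : Fin (p + 1) → VField n M, (∀ i, SmoothFieldAt (Y i) x) →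
        nablaForm cov θ (Y 0) (fun i => Y i.succ) x = α (fun i => Y i x)

/-- The coordinate vector field `∂/∂xⁱ` of the chart `φ = (x¹, …, xⁿ)`: the pull-back under `φ` of
the constant field `eᵢ` on `ℝⁿ`. It is meaningful on `φ.source`. -/
def coordField (φ : OpenPartialHomeomorph M (Rn n)) (i : Fin n) : VField n M :=
  VectorField.mpullback 𝓘(ℝ, Rn n) 𝓘(ℝ, Rn n) φ
    (fun _ => (EuclideanSpace.single i (1 : ℝ) : Rn n))

/-- The component `θ_{i₁ … i_p} = θ(∂/∂x^{i₁}, …, ∂/∂x^{i_p})` of `θ` in the chart `φ`, at `x`. -/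
def component (φ : OpenPartialHomeomorph M (Rn n)) {p : ℕ} (θ : FormField n M p)
    (i : Fin p → Fin n) (x : M) : ℝ :=
  θ x (fun j => coordField φ (i j) x)

/-- `ψ = (n + 1)⁻¹ ln η`, where `η` stands for the component `η_{1 … n}` of the volume element in
the chart `φ`. -/
def psi (φ : OpenPartialHomeomorph M (Rn n)) (η : FormField n M n) (x : M) : ℝ :=
  ((n : ℝ) + 1)⁻¹ * Real.log (component φ η id x)

end

/-- The array of constants `A_{i₁ … i_q}` is skew-symmetric with respect to all its indices. -/
def IsSkew {n q : ℕ} (A : (Fin q → Fin n) → ℝ) : Prop :=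
  ∀ (σ : Equiv.Perm (Fin q)) (i : Fin q → Fin n), A (i ∘ σ) = (Equiv.Perm.sign σ : ℤ) * A i

end Equiaffine

end

open Equiaffine

/-! Vanishing Weyl curvature should make the manifold locally projectively flat. With `P =
Ric/(n-1)`, the overdetermined equation `∇∇f + f P = 0` prolongs to a linear connection on pairs
`(f, df)`. The curvature of that connection is made of `P(u,v) - P(v,u)`, the torsion, the Weyl
tensor and the Codazzi defect of `P`. The first Bianchi identity kills the antisymmetric part of `P`
(`IsProjectivelyFlat.schouten_symm`), and the second kills the Codazzi defect
(`IsProjectivelyFlat.codazzi`). Both arguments need a direction transverse to two given vectors,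
hence `n > 2`. The prolongation is therefore flat, and `exists_hasFDerivAt_of_flat` gives solutions
with any initial value and differential.

Let `g` be a scalar solution with `g = 1`, `dg = 0` at the point, and `f` a vector-valued one with
`f = 0`, `df` invertible. In the coordinates `Φ = f/g` the Christoffel symbols become `Γ(u,v) = λ(u)
v + λ(v) u` (`exists_projective_chart`).

In such coordinates a parallel volume form satisfies `dη = (n+1) λ η` on its single component, so `λ
= dψ` (`IsChristoffel.hasFDerivAt_log_volume`). For a `p`-form, `∇ω` equals `∂ω - (p+1) λ ⊗ ω` plus
the form `λ ∧ ω`, which is already skew. Hence `ω` is Killing–Yano exactly when `∂τ` is totally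
skew, where `τ = e^{-(p+1)ψ} ω`. Then `∂∂τ` is symmetric in its first two slots and skew in the
remaining ones together with the second, so it vanishes and `τ` is affine with skew linear part
(`exists_affine_of_fderiv_skew`). The converse is the same computation read backwards. -/

namespace Equiaffine

set_option maxSynthPendingDepth 3
set_option linter.unusedSectionVars false

/-! ### Linear total differential systems: a Frobenius theorem for flat connections -/

open Set Metric Filter Topology

section Frobenius

variable {E V : Type*} [NormedAddCommGroup E] [NormedSpace ℝ E]
  [NormedAddCommGroup V] [NormedSpace ℝ V]

/-- Grönwall estimates take right derivatives, whereas Picard–Lindelöf supplies derivatives within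
the closed interval. -/
lemma hasDerivWithinAt_Ici_of_Icc {u : ℝ → V} {u' : V} {t : ℝ} (ht : t ∈ Ico (0 : ℝ) 1)
    (h : HasDerivWithinAt u u' (Icc 0 1) t) : HasDerivWithinAt u u' (Ici t) t :=
  h.mono_of_mem_nhdsWithin
    (Filter.mem_of_superset (Icc_mem_nhdsGE ht.2) (Icc_subset_Icc_left ht.1))

/-- Existence for a linear differential equation on `[0, 1]` with small coefficients. -/
lemma exists_linear_ode_solution [CompleteSpace V] {B : ℝ → V →L[ℝ] V}
    (hB : ContinuousOn B (Icc 0 1)) (hb : ∀ t ∈ Icc (0 : ℝ) 1, ‖B t‖ ≤ 1 / 2) (F₀ : V) :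
    ∃ u : ℝ → V, u 0 = F₀ ∧
      (∀ t ∈ Icc (0 : ℝ) 1, HasDerivWithinAt u (B t (u t)) (Icc 0 1) t) ∧
      ∀ t ∈ Icc (0 : ℝ) 1, ‖u t‖ ≤ ‖F₀‖ * Real.exp 1 := by
  -- On the ball of radius `‖F₀‖ + 1` about `F₀` the speed is at most `(2‖F₀‖ + 1)/2 ≤ ‖F₀‖ + 1`, so
  -- the solution cannot leave the ball before time 1.
  have hpl : IsPicardLindelof (fun t x => B t x) (tmin := 0) (tmax := 1) ⟨0, by simp⟩ F₀
      (‖F₀‖₊ + 1) 0 (‖F₀‖₊ + 1) 1 := by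
    refine ⟨fun t ht => ?_, fun x _ => hB.clm_apply continuousOn_const, fun t ht x hx => ?_, ?_⟩
    · refine ((B t).lipschitz.weaken ?_).lipschitzOnWith
      have := hb t ht
      rw [← NNReal.coe_le_coe]
      simp only [coe_nnnorm, NNReal.coe_one]
      linarith
    · have h1 := (B t).le_of_opNorm_le (hb t ht) x
      have h2 : ‖x‖ ≤ ‖F₀‖ + ‖x - F₀‖ := by
        calc ‖x‖ = ‖F₀ + (x - F₀)‖ := by congr 1; abel
          _ ≤ _ := norm_add_le _ _
      have h3 : ‖x - F₀‖ ≤ ‖F₀‖ + 1 := by simpa [dist_eq_norm] using hx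
      simp only [NNReal.coe_add, coe_nnnorm, NNReal.coe_one]
      linarith
    · simp
  obtain ⟨u, hu0, hu⟩ := hpl.exists_eq_forall_mem_Icc_hasDerivWithinAt₀
  refine ⟨u, hu0, hu, fun t ht => ?_⟩
  have hg := norm_le_gronwallBound_of_norm_deriv_right_le (f := u) (f' := fun t => B t (u t))
    (δ := ‖F₀‖) (K := 1 / 2) (ε := 0) (a := 0) (b := 1) (fun t ht => (hu t ht).continuousWithinAt)
    (fun t ht => hasDerivWithinAt_Ici_of_Icc ht (hu t (Ico_subset_Icc_self ht)))
    (by rw [← hu0]) (fun t ht => by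
      have := (B t).le_of_opNorm_le (hb t (Ico_subset_Icc_self ht)) (u t)
      linarith) t ht
  rw [gronwallBound_ε0] at hg
  refine hg.trans ?_
  gcongr
  linarith [ht.2]

lemma hasDerivAt_comp_line {G : Type*} [NormedAddCommGroup G] [NormedSpace ℝ G] {f : E → G}
    {f' : E →L[ℝ] G} {x h : E} {t : ℝ} (hf : HasFDerivAt f f' (x + t • h)) :
    HasDerivAt (fun t : ℝ => f (x + t • h)) (f' h) t := by
  have h1 : HasDerivAt (fun t : ℝ => x + t • h) h t := by
    simpa using ((hasDerivAt_id t).smul_const h).const_add x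
  exact HasFDerivAt.comp_hasDerivAt (f := fun t : ℝ => x + t • h) t hf h1

lemma hasDerivWithinAt_clm_apply₂ {F G H : Type*} [NormedAddCommGroup F] [NormedSpace ℝ F]
    [NormedAddCommGroup G] [NormedSpace ℝ G] [NormedAddCommGroup H] [NormedSpace ℝ H]
    {a : ℝ → F →L[ℝ] G →L[ℝ] H} {a' : F →L[ℝ] G →L[ℝ] H} {b : ℝ → F} {b' : F} {c : ℝ → G} {c' : G}
    {s : Set ℝ} {t : ℝ} (ha : HasDerivWithinAt a a' s t) (hb : HasDerivWithinAt b b' s t)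
    (hc : HasDerivWithinAt c c' s t) :
    HasDerivWithinAt (fun t => a t (b t) (c t))
      ((a' (b t) + a t b') (c t) + a t (b t) c') s t := by
  have h1 := ha.clm_apply hb
  exact h1.clm_apply hc

omit [NormedSpace ℝ E] in
lemma eventually_norm_le_add_one {G : Type*} [NormedAddCommGroup G] {f : E → G} {Ω : Set E}
    (hΩ : IsOpen Ω) (hf : ContinuousOn f Ω) {x₀ : E} (hx₀ : x₀ ∈ Ω) :
    ∀ᶠ x in 𝓝 x₀, ‖f x‖ ≤ ‖f x₀‖ + 1 := by
  have := (hf.continuousAt (hΩ.mem_nhds hx₀)).norm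
  exact (this.eventually (gt_mem_nhds (lt_add_one _))).mono fun x hx => hx.le

/-- Local bounds on a twice continuously differentiable function and its derivative. -/
lemma exists_ball_norm_bounds {G : Type*} [NormedAddCommGroup G] [NormedSpace ℝ G]
    {A : E → G} {Ω : Set E} (hΩ : IsOpen Ω)
    (hA : ContDiffOn ℝ ∞ A Ω) {x₀ : E} (hx₀ : x₀ ∈ Ω) :
    ∃ C > 0, ∃ r > 0, C * r ≤ 1 / 2 ∧ ball x₀ r ⊆ Ω ∧ (∀ x ∈ ball x₀ r, ‖A x‖ ≤ C) ∧
      (∀ x ∈ ball x₀ r, ‖fderiv ℝ A x‖ ≤ C) ∧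
      ∀ x ∈ ball x₀ r, ∀ y ∈ ball x₀ r, ‖A y - A x - fderiv ℝ A x (y - x)‖ ≤ C * ‖y - x‖ ^ 2 := by
  have hA1 : ContDiffOn ℝ ∞ (fderiv ℝ A) Ω := hA.fderiv_of_isOpen hΩ (by simp)
  have hA2 : ContDiffOn ℝ ∞ (fderiv ℝ (fderiv ℝ A)) Ω := hA1.fderiv_of_isOpen hΩ (by simp)
  obtain ⟨R, hR, hball⟩ := Metric.eventually_nhds_iff_ball.1
    (((hΩ.eventually_mem hx₀).and (eventually_norm_le_add_one hΩ hA.continuousOn hx₀)).and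
      ((eventually_norm_le_add_one hΩ hA1.continuousOn hx₀).and
        (eventually_norm_le_add_one hΩ hA2.continuousOn hx₀)))
  -- One constant dominates `A` and its first two derivatives; `r` is then small enough that the
  -- equation along any ray of length below `r` has coefficients at most `1/2`.
  set C := (‖A x₀‖ + 1) + (‖fderiv ℝ A x₀‖ + 1) + (‖fderiv ℝ (fderiv ℝ A) x₀‖ + 1) with hC
  have n1 := norm_nonneg (A x₀)
  have n2 := norm_nonneg (fderiv ℝ A x₀)
  have n3 := norm_nonneg (fderiv ℝ (fderiv ℝ A) x₀)
  have hCpos : 0 < C := by positivity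
  set r := min R (1 / (2 * C))
  have hr : 0 < r := lt_min hR (by positivity)
  have hsub : ball x₀ r ⊆ ball x₀ R := ball_subset_ball (min_le_left _ _)
  refine ⟨C, hCpos, r, hr, ?_, fun x hx => (hball x (hsub hx)).1.1,
    fun x hx => (hball x (hsub hx)).1.2.trans (by linarith),
    fun x hx => (hball x (hsub hx)).2.1.trans (by linarith), fun x hx y hy => ?_⟩
  · calc C * r ≤ C * (1 / (2 * C)) := by gcongr; exact min_le_right _ _
      _ = 1 / 2 := by field_simp
  · have hseg : segment ℝ x y ⊆ ball x₀ r := (convex_ball x₀ r).segment_subset hx hy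
    have hd : ∀ z ∈ ball x₀ r, ∀ w ∈ ball x₀ r,
        ‖fderiv ℝ A z - fderiv ℝ A w‖ ≤ C * ‖z - w‖ := fun z hz w hw =>
      (convex_ball x₀ r).norm_image_sub_le_of_norm_fderiv_le (𝕜 := ℝ)
        (fun v hv => ((hA1.contDiffAt (hΩ.mem_nhds (hball v (hsub hv)).1.1)).differentiableAt
          (by simp)))
        (fun v hv => (hball v (hsub hv)).2.2.trans (by linarith)) hw hz
    have := (convex_segment x y).norm_image_sub_le_of_norm_fderiv_le' (𝕜 := ℝ) (f := A)
      (φ := fderiv ℝ A x) (C := C * ‖y - x‖)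
      (fun v hv => ((hA.contDiffAt (hΩ.mem_nhds (hball v (hsub (hseg hv))).1.1)).differentiableAt
          (by simp)))
      (fun v hv => (hd v (hseg hv) x hx).trans (by
        gcongr
        obtain ⟨a, b, ha, hb, hab, rfl⟩ := hv
        have : a • x + b • y - x = b • (y - x) := by
          rw [show a = 1 - b by linarith]; module
        rw [this, norm_smul, Real.norm_of_nonneg hb]
        exact mul_le_of_le_one_left (norm_nonneg _) (by linarith)))
      (left_mem_segment ℝ x y) (right_mem_segment ℝ x y)
    calc _ ≤ _ := this
      _ = _ := by ring

lemma norm_clm_apply₂_le {T : E →L[ℝ] V →L[ℝ] V} {C : ℝ} (hT : ‖T‖ ≤ C) (a : E) (b : V) :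
    ‖T a b‖ ≤ C * ‖a‖ * ‖b‖ :=
  (T.le_opNorm₂ a b).trans (by gcongr)

/-- The deviation of the first order approximation `U + t a(k) U` from satisfying the differential
equation along the ray through `h + k` is quadratic in `k`. -/
lemma norm_deviation_le {a az : E →L[ℝ] V →L[ℝ] V} {d : E →L[ℝ] E →L[ℝ] V →L[ℝ] V}
    {C r N t : ℝ} (hC : 0 < C) (hr : 0 < r) (hN0 : 0 ≤ N) (hCr : C * r ≤ 1 / 2)
    (ht : t ∈ Icc (0 : ℝ) 1) (ha : ‖a‖ ≤ C)
    (hd : ‖d‖ ≤ C) {h k : E} (hR : ‖az - a - d (t • k)‖ ≤ C * ‖k‖ ^ 2) (hk : ‖h + k‖ ≤ r)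
    (hkr : ‖k‖ ≤ 2 * r) {U : V} (hU : ‖U‖ ≤ N)
    (hfl : d k h U - d h k U + a h (a k U) - a k (a h U) = 0) :
    ‖az (h + k) (U + a (t • k) U) - (a h U + ((d h (t • k) + a k) U + a (t • k) (a h U)))‖ ≤
      (C * C * N + C * N + C * r * C * N + C * r * (2 * N)) * ‖k‖ ^ 2 := by
  set R := az - a - d (t • k) with hRdef
  have htk : ‖t • k‖ ≤ ‖k‖ := by
    rw [norm_smul, Real.norm_of_nonneg ht.1]
    exact mul_le_of_le_one_left (norm_nonneg _) ht.2
  have hwb : ‖U + a (t • k) U‖ ≤ 2 * N := by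
    calc _ ≤ ‖U‖ + ‖a (t • k) U‖ := norm_add_le _ _
      _ ≤ N + C * ‖t • k‖ * ‖U‖ := add_le_add hU (norm_clm_apply₂_le ha _ _)
      _ ≤ N + C * (2 * r) * N := by gcongr; exact htk.trans hkr
      _ = N + 2 * (C * r) * N := by ring
      _ ≤ N + 2 * (1 / 2) * N := by gcongr
      _ = _ := by ring
  have hAz : az = a + d (t • k) + R := by rw [hRdef]; abel
  -- Subtracting `t` times the flatness identity removes every term of first order in `k`; the four
  -- terms left give the four summands of the constant.
  have hfl' : t • (d k h U - d h k U + a h (a k U) - a k (a h U)) = 0 := by rw [hfl, smul_zero]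
  have hdiff : az (h + k) (U + a (t • k) U) - (a h U + ((d h (t • k) + a k) U + a (t • k) (a h U)))
      = a k (a (t • k) U) + d (t • k) k U + d (t • k) (h + k) (a (t • k) U)
        + R (h + k) (U + a (t • k) U) := by
    rw [hAz, ← sub_eq_zero, ← hfl']
    simp only [_root_.add_apply, map_add, map_smul, _root_.smul_apply, smul_sub, smul_add]
    abel
  rw [hdiff]
  have hak : ‖a (t • k) U‖ ≤ C * ‖k‖ * N :=
    (norm_clm_apply₂_le ha _ _).trans (by gcongr)
  have e1 : ‖a k (a (t • k) U)‖ ≤ C * C * N * ‖k‖ ^ 2 := by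
    calc _ ≤ C * ‖k‖ * ‖a (t • k) U‖ := norm_clm_apply₂_le ha _ _
      _ ≤ C * ‖k‖ * (C * ‖k‖ * N) := by gcongr
      _ = _ := by ring
  have hDA : ‖d (t • k)‖ ≤ C * ‖k‖ := (d.le_of_opNorm_le hd _).trans (by gcongr)
  have e2 : ‖d (t • k) k U‖ ≤ C * N * ‖k‖ ^ 2 := by
    calc _ ≤ C * ‖k‖ * ‖k‖ * ‖U‖ := norm_clm_apply₂_le hDA _ _
      _ ≤ C * ‖k‖ * ‖k‖ * N := by gcongr
      _ = _ := by ring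
  have e3 : ‖d (t • k) (h + k) (a (t • k) U)‖ ≤ C * r * C * N * ‖k‖ ^ 2 := by
    calc _ ≤ C * ‖k‖ * ‖h + k‖ * ‖a (t • k) U‖ := norm_clm_apply₂_le hDA _ _
      _ ≤ C * ‖k‖ * r * (C * ‖k‖ * N) := by gcongr
      _ = _ := by ring
  have e4 : ‖R (h + k) (U + a (t • k) U)‖ ≤ C * r * (2 * N) * ‖k‖ ^ 2 := by
    calc _ ≤ C * ‖k‖ ^ 2 * ‖h + k‖ * ‖U + a (t • k) U‖ := norm_clm_apply₂_le hR _ _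
      _ ≤ C * ‖k‖ ^ 2 * r * (2 * N) := by gcongr
      _ = _ := by ring
  refine norm_add₄_le.trans ?_
  linarith

set_option maxHeartbeats 400000 in
/-- Local solvability of the total differential system `DF(x) u = A(x) u F(x)` under the
integrability condition that the linear connection `d - A` be flat. -/
theorem exists_hasFDerivAt_of_flat [CompleteSpace V] {A : E → E →L[ℝ] V →L[ℝ] V} {Ω : Set E}
    (hΩ : IsOpen Ω) (hA : ContDiffOn ℝ ∞ A Ω)
    (hflat : ∀ x ∈ Ω, ∀ u v : E, ∀ F : V, fderiv ℝ A x u v F - fderiv ℝ A x v u F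
      + A x v (A x u F) - A x u (A x v F) = 0) {x₀ : E} (hx₀ : x₀ ∈ Ω) (F₀ : V) :
    ∃ F : E → V, F x₀ = F₀ ∧ ∃ r > 0, ball x₀ r ⊆ Ω ∧
      ∀ x ∈ ball x₀ r, HasFDerivAt F ((A x).flip (F x)) x := by
  obtain ⟨C, hC, r, hr, hCr, hsub, hA0, hA1, hA2⟩ := exists_ball_norm_bounds hΩ hA hx₀
  have hmem : ∀ h : E, ‖h‖ < r → ∀ t ∈ Icc (0 : ℝ) 1, x₀ + t • h ∈ ball x₀ r := by
    intro h hh t ht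
    rw [mem_ball, dist_eq_norm, add_sub_cancel_left, norm_smul, Real.norm_of_nonneg ht.1]
    exact (mul_le_of_le_one_left (norm_nonneg _) ht.2).trans_lt hh
  have hdA : ∀ x ∈ ball x₀ r, HasFDerivAt A (fderiv ℝ A x) x := fun x hx =>
    ((hA.contDiffAt (hΩ.mem_nhds (hsub hx))).differentiableAt (by simp)).hasFDerivAt
  have hray : ∀ h : E, ‖h‖ < r → ∀ t ∈ Icc (0 : ℝ) 1,
      HasDerivAt (fun t : ℝ => A (x₀ + t • h)) (fderiv ℝ A (x₀ + t • h) h) t := by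
    intro h hh t ht
    exact hasDerivAt_comp_line (G := E →L[ℝ] V →L[ℝ] V) (hdA _ (hmem h hh t ht))
  have hBbound : ∀ h : E, ‖h‖ < r → ∀ t ∈ Icc (0 : ℝ) 1, ‖A (x₀ + t • h) h‖ ≤ 1 / 2 := by
    intro h hh t ht
    calc _ ≤ C * ‖h‖ := (A _).le_of_opNorm_le (hA0 _ (hmem h hh t ht)) h
      _ ≤ C * r := by gcongr
      _ ≤ _ := hCr
  -- Solve along each ray from `x₀`. The candidate for `F` at `x₀ + h` is the value at time 1, and
  -- flatness is needed only to see that `F` has the right derivative off the ray.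
  have hex : ∀ h : E, ∃ u : ℝ → V, ‖h‖ < r → u 0 = F₀ ∧
      (∀ t ∈ Icc (0 : ℝ) 1, HasDerivWithinAt u (A (x₀ + t • h) h (u t)) (Icc 0 1) t) ∧
      ∀ t ∈ Icc (0 : ℝ) 1, ‖u t‖ ≤ ‖F₀‖ * Real.exp 1 := by
    intro h
    by_cases hh : ‖h‖ < r
    · obtain ⟨u, hu⟩ := exists_linear_ode_solution (B := fun t => A (x₀ + t • h) h)
        (fun t ht => ((hray h hh t ht).clm_apply
          (hasDerivAt_const t h)).continuousAt.continuousWithinAt) (hBbound h hh) F₀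
      exact ⟨u, fun _ => hu⟩
    · exact ⟨0, fun h => absurd h hh⟩
  choose u hu using hex
  set N := ‖F₀‖ * Real.exp 1 with hN
  have hN0 : 0 ≤ N := by positivity
  set D := C * C * N + C * N + C * r * C * N + C * r * (2 * N) with hD
  have hD0 : 0 ≤ D := by positivity
  refine ⟨fun x => u (x - x₀) 1, ?_, r, hr, hsub, fun x hx => ?_⟩
  · simp only [sub_self]
    have h0 := hu 0 (by simpa using hr)
    have := constant_of_has_deriv_right_zero (f := u 0) (a := 0) (b := 1)
      (fun t ht => (h0.2.1 t ht).continuousWithinAt)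
      (fun t ht => by
        simpa using hasDerivWithinAt_Ici_of_Icc ht (h0.2.1 t (Ico_subset_Icc_self ht)))
      1 (by simp)
    rw [this, h0.1]
  -- the error of the first order approximation is quadratic
  set h := x - x₀ with hh
  have hx' : x = x₀ + (1 : ℝ) • h := by rw [hh]; simp
  have hhr : ‖h‖ < r := by simpa [hh, dist_eq_norm] using hx
  have hest : ∀ k : E, ‖h + k‖ < r →
      ‖u (h + k) 1 - u h 1 - A x k (u h 1)‖ ≤ (D * Real.exp 1) * ‖k‖ ^ 2 := by
    intro k hk
    have hkr : ‖k‖ ≤ 2 * r := by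
      calc ‖k‖ = ‖(h + k) - h‖ := by congr 1; abel
        _ ≤ ‖h + k‖ + ‖h‖ := norm_sub_le _ _
        _ ≤ _ := by linarith
    obtain ⟨hu0, hud, hub⟩ := hu h hhr
    obtain ⟨hv0, hvd, hvb⟩ := hu (h + k) hk
    -- First-order transport of the solution along `h` to the neighbouring ray along `h + k`. It is
    -- an approximate trajectory there with error `O(‖k‖²)`, so Grönwall gives differentiability
    -- without any theorem on dependence on parameters.
    set w : ℝ → V := fun t => u h t + A (x₀ + t • h) (t • k) (u h t) with hw
    set w' : ℝ → V := fun t => A (x₀ + t • h) h (u h t)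
      + ((fderiv ℝ A (x₀ + t • h) h (t • k) + A (x₀ + t • h) k) (u h t)
        + A (x₀ + t • h) (t • k) (A (x₀ + t • h) h (u h t))) with hw'
    have hwd : ∀ t ∈ Icc (0 : ℝ) 1, HasDerivWithinAt w (w' t) (Icc 0 1) t := by
      intro t ht
      have h1 : HasDerivWithinAt (fun t : ℝ => t • k) k (Icc 0 1) t := by
        simpa using ((hasDerivAt_id t).smul_const k).hasDerivWithinAt
      have h3 := hasDerivWithinAt_clm_apply₂ (F := E) (G := V) (H := V)
        (a := fun t : ℝ => A (x₀ + t • h)) (b := fun t : ℝ => t • k) (c := u h)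
        (hray h hhr t ht).hasDerivWithinAt h1 (hud t ht)
      exact (hud t ht).add h3
    have hbd : ∀ t ∈ Ico (0 : ℝ) 1,
        dist (w' t) (A (x₀ + t • (h + k)) (h + k) (w t)) ≤ D * ‖k‖ ^ 2 := by
      intro t ht'
      have ht := Ico_subset_Icc_self ht'
      set y := x₀ + t • h with hy
      have hym : y ∈ ball x₀ r := hmem h hhr t ht
      have hzm : x₀ + t • (h + k) ∈ ball x₀ r := hmem _ hk t ht
      have hyz : x₀ + t • (h + k) - y = t • k := by rw [hy]; module
      have htk : ‖t • k‖ ≤ ‖k‖ := by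
        rw [norm_smul, Real.norm_of_nonneg ht.1]
        exact mul_le_of_le_one_left (norm_nonneg _) ht.2
      have hRb := hA2 y hym _ hzm
      rw [hyz] at hRb
      rw [dist_comm, dist_eq_norm]
      exact norm_deviation_le hC hr hN0 hCr ht (hA0 y hym) (hA1 y hym)
        (hRb.trans (by gcongr)) hk.le hkr (hub t ht) (hflat y (hsub hym) k h (u h t))
    have hlip : ∀ t ∈ Ico (0 : ℝ) 1, LipschitzOnWith 1
        (fun y : V => A (x₀ + t • (h + k)) (h + k) y) univ := by
      intro t ht
      refine (((A (x₀ + t • (h + k)) (h + k)).lipschitz).weaken ?_).lipschitzOnWith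
      have := hBbound (h + k) hk t (Ico_subset_Icc_self ht)
      rw [← NNReal.coe_le_coe]
      simp only [coe_nnnorm, NNReal.coe_one]
      linarith
    have hgr := dist_le_of_approx_trajectories_ODE_of_mem (δ := 0) (εf := 0)
      (s := fun _ => (univ : Set V)) hlip
      (fun t ht => (hvd t ht).continuousWithinAt)
      (fun t ht => hasDerivWithinAt_Ici_of_Icc ht (hvd t (Ico_subset_Icc_self ht)))
      (fun t _ => (dist_self _).le) (fun t _ => mem_univ _)
      (fun t ht => (hwd t ht).continuousWithinAt)
      (fun t ht => hasDerivWithinAt_Ici_of_Icc ht (hwd t (Ico_subset_Icc_self ht)))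
      hbd (fun t _ => mem_univ _) (by simp [hv0, hw, hu0]) 1 (by simp)
    rw [gronwallBound_of_K_ne_0 (by simp), dist_eq_norm] at hgr
    have hw1 : w 1 = u h 1 + A x k (u h 1) := by simp only [hw]; rw [← hx', one_smul]
    rw [hw1] at hgr
    simp only [NNReal.coe_one, zero_mul, zero_add, div_one, sub_zero, mul_one] at hgr
    rw [← sub_sub] at hgr
    refine hgr.trans ?_
    have : 0 ≤ D * ‖k‖ ^ 2 := by positivity
    nlinarith [Real.exp_pos 1]
  rw [hasFDerivAt_iff_isLittleO_nhds_zero]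
  have hO : (fun k => u (x + k - x₀) 1 - u h 1 - (A x).flip (u h 1) k)
      =O[𝓝 0] fun k => ‖k‖ ^ 2 := by
    refine Asymptotics.IsBigO.of_bound (D * Real.exp 1) ?_
    have : ∀ᶠ k : E in 𝓝 0, ‖h + k‖ < r := by
      have hc : ContinuousAt (fun k : E => ‖h + k‖) 0 := by fun_prop
      exact hc.eventually (gt_mem_nhds (by simpa using hhr))
    filter_upwards [this] with k hk
    have hxk : x + k - x₀ = h + k := by rw [hh]; abel
    rw [hxk]
    simpa using hest k hk
  exact hO.trans_isLittleO (Asymptotics.isLittleO_norm_pow_id one_lt_two)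

/-- Solutions of a smooth total differential system are smooth. -/
lemma contDiffOn_of_hasFDerivAt {A : E → E →L[ℝ] V →L[ℝ] V} {W : Set E} (hW : IsOpen W)
    (hA : ContDiffOn ℝ ∞ A W) {F : E → V}
    (hF : ∀ x ∈ W, HasFDerivAt F ((A x).flip (F x)) x) : ContDiffOn ℝ ∞ F W := by
  rw [contDiffOn_infty]
  intro k
  -- Bootstrap: the derivative is the smooth expression `(A x).flip (F x)`, so it is as regular as
  -- `F`, which gains one order.
  induction k with
  | zero => exact contDiffOn_zero.2 fun x hx => (hF x hx).continuousAt.continuousWithinAt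
  | succ k ih =>
    push_cast
    rw [contDiffOn_succ_iff_fderiv_of_isOpen hW]
    refine ⟨fun x hx => (hF x hx).differentiableAt.differentiableWithinAt, by simp, ?_⟩
    have hflip : ContDiffOn ℝ k (fun x => (A x).flip) W := by
      have := ContinuousLinearMap.contDiff (𝕜 := ℝ) (E := E →L[ℝ] V →L[ℝ] V)
        (F := V →L[ℝ] E →L[ℝ] V) (n := k)
        (ContinuousLinearMap.flipₗᵢ ℝ E V V).toContinuousLinearEquiv.toContinuousLinearMap
      exact this.comp_contDiffOn (contDiffOn_infty.1 hA k)
    exact (hflip.clm_apply ih).congr fun x hx => (hF x hx).fderiv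

end Frobenius

/-! ### Derivatives along lines, used to differentiate identities valid on open sets -/

section LineDerivatives

variable {E F G : Type*} [NormedAddCommGroup E] [NormedSpace ℝ E]
  [NormedAddCommGroup F] [NormedSpace ℝ F] [NormedAddCommGroup G] [NormedSpace ℝ G]

lemma hasDerivAt_comp_line_zero {f : E → G} {f' : E →L[ℝ] G} {x : E}
    (hf : HasFDerivAt f f' x) (h : E) :
    HasDerivAt (fun t : ℝ => f (x + t • h)) (f' h) 0 :=
  hasDerivAt_comp_line (by simpa using hf)

lemma hasDerivAt_clm_apply_const {a : ℝ → F →L[ℝ] G} {a' : F →L[ℝ] G} {t : ℝ}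
    (ha : HasDerivAt a a' t) (b : F) : HasDerivAt (fun t => a t b) (a' b) t := by
  simpa using ha.clm_apply (hasDerivAt_const t b)

lemma eventually_line_mem {Ω : Set E} (hΩ : IsOpen Ω) {x : E} (hx : x ∈ Ω) (h : E) :
    ∀ᶠ t : ℝ in 𝓝 0, x + t • h ∈ Ω := by
  have hc : ContinuousAt (fun t : ℝ => x + t • h) 0 := by fun_prop
  exact hc.eventually (hΩ.mem_nhds (by simpa using hx))

/-- Functions agreeing on an open set have the same derivatives along lines. -/
lemma hasDerivAt_line_unique {Ω : Set E} (hΩ : IsOpen Ω) {x : E} (hx : x ∈ Ω) (h : E)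
    {f g : E → G} (hfg : ∀ y ∈ Ω, f y = g y) {a b : G}
    (hf : HasDerivAt (fun t : ℝ => f (x + t • h)) a 0)
    (hg : HasDerivAt (fun t : ℝ => g (x + t • h)) b 0) : a = b := by
  refine hf.unique (hg.congr_of_eventuallyEq ?_)
  filter_upwards [eventually_line_mem hΩ hx h] with t ht using hfg _ ht

lemma ContDiffOn.hasFDerivAt_of_isOpen {f : E → G} {Ω : Set E} (hf : ContDiffOn ℝ ∞ f Ω)
    (hΩ : IsOpen Ω) {x : E} (hx : x ∈ Ω) : HasFDerivAt f (fderiv ℝ f x) x :=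
  ((hf.contDiffAt (hΩ.mem_nhds hx)).differentiableAt (by simp)).hasFDerivAt

lemma ContDiffOn.fderiv_fderiv_symm {f : E → G} {Ω : Set E} (hf : ContDiffOn ℝ ∞ f Ω)
    (hΩ : IsOpen Ω) {x : E} (hx : x ∈ Ω) (u v : E) :
    fderiv ℝ (fderiv ℝ f) x u v = fderiv ℝ (fderiv ℝ f) x v u :=
  (hf.contDiffAt (hΩ.mem_nhds hx)).isSymmSndFDerivAt
    (by simpa using WithTop.coe_le_coe.2 (le_top : (2 : ℕ∞) ≤ ⊤)) u v

end LineDerivatives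

/-! ### Bianchi identities for a connection with vanishing Weyl curvature -/

section Projective

variable {E : Type*} [NormedAddCommGroup E] [NormedSpace ℝ E]

/-- `Γ` is a smooth torsion-free linear connection on the open set `Ω` of a vector space whose
curvature is `R(u, v)w = P(v, w) u - P(u, w) v`. -/
structure IsProjectivelyFlat (Γ : E → E →L[ℝ] E →L[ℝ] E) (P : E → E →L[ℝ] E →L[ℝ] ℝ)
    (Ω : Set E) : Prop where
  isOpen : IsOpen Ω
  contDiffOn : ContDiffOn ℝ ∞ Γ Ω
  contDiffOn_schouten : ContDiffOn ℝ ∞ P Ω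
  symm : ∀ x ∈ Ω, ∀ u v, Γ x u v = Γ x v u
  curvature : ∀ x ∈ Ω, ∀ u v w, fderiv ℝ Γ x u v w - fderiv ℝ Γ x v u w + Γ x u (Γ x v w)
    - Γ x v (Γ x u w) = P x v w • u - P x u w • v

variable {Γ : E → E →L[ℝ] E →L[ℝ] E} {P : E → E →L[ℝ] E →L[ℝ] ℝ} {Ω : Set E}

lemma IsProjectivelyFlat.hasDerivAt (h : IsProjectivelyFlat Γ P Ω) {x : E} (hx : x ∈ Ω)
    (u v w : E) : HasDerivAt (fun t : ℝ => Γ (x + t • u) v w) (fderiv ℝ Γ x u v w) 0 :=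
  hasDerivAt_clm_apply_const (hasDerivAt_clm_apply_const (hasDerivAt_comp_line_zero
    (ContDiffOn.hasFDerivAt_of_isOpen h.contDiffOn h.isOpen hx) u) v) w

lemma IsProjectivelyFlat.hasDerivAt_schouten (h : IsProjectivelyFlat Γ P Ω) {x : E} (hx : x ∈ Ω)
    (u v w : E) : HasDerivAt (fun t : ℝ => P (x + t • u) v w) (fderiv ℝ P x u v w) 0 :=
  hasDerivAt_clm_apply_const (hasDerivAt_clm_apply_const (hasDerivAt_comp_line_zero
    (ContDiffOn.hasFDerivAt_of_isOpen h.contDiffOn_schouten h.isOpen hx) u) v) w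

lemma IsProjectivelyFlat.fderiv_symm (h : IsProjectivelyFlat Γ P Ω) {x : E} (hx : x ∈ Ω)
    (u v w : E) : fderiv ℝ Γ x u v w = fderiv ℝ Γ x u w v :=
  hasDerivAt_line_unique h.isOpen hx u (f := fun y => Γ y v w) (g := fun y => Γ y w v)
    (fun y hy => h.symm y hy v w) (h.hasDerivAt hx u v w) (h.hasDerivAt hx u w v)

/-- Any two vectors lie in the kernel of some nonzero linear form. -/
def HasTransversals (E : Type*) [NormedAddCommGroup E] [NormedSpace ℝ E] : Prop :=
  ∀ u v : E, ∃ (z : E) (ℓ : E →L[ℝ] ℝ), ℓ z = 1 ∧ ℓ u = 0 ∧ ℓ v = 0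

/-- The first Bianchi identity makes the Schouten tensor symmetric. -/
lemma IsProjectivelyFlat.schouten_symm (h : IsProjectivelyFlat Γ P Ω) (hE : HasTransversals E)
    {x : E} (hx : x ∈ Ω) (u v : E) : P x u v = P x v u := by
  obtain ⟨z, ℓ, hz, hu, hv⟩ := hE u v
  -- The cyclic sum of curvatures vanishes by torsion-freeness; the form `ℓ` extracts the
  -- coefficient of `z`, which is `P(u,v) - P(v,u)`.
  have h1 := h.curvature x hx u v z
  have h2 := h.curvature x hx v z u
  have h3 := h.curvature x hx z u v
  rw [h.fderiv_symm hx u v z, h.fderiv_symm hx v u z, h.symm x hx v z, h.symm x hx u z] at h1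
  rw [h.fderiv_symm hx z v u, h.symm x hx v u, h.fderiv_symm hx v z u] at h2
  rw [h.fderiv_symm hx u z v] at h3
  have h4 : (P x v z • u - P x u z • v) + (P x z u • v - P x v u • z)
      + (P x u v • z - P x z v • u) = 0 := by
    rw [← h1, ← h2, ← h3, h.fderiv_symm hx v u z, h.fderiv_symm hx u v z, h.symm x hx z u,
      h.symm x hx z v]
    abel
  have h5 := congrArg ℓ h4
  simp only [map_add, map_sub, map_smul, hz, hu, hv, smul_eq_mul, mul_zero, mul_one, map_zero] at h5
  linarith

/-- The curvature equation differentiated in the direction `z`: the ingredient of the second Bianchi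
identity, with ordinary in place of covariant derivatives. -/
lemma IsProjectivelyFlat.fderiv_curvature (h : IsProjectivelyFlat Γ P Ω) {x : E} (hx : x ∈ Ω)
    (z u v w : E) :
    fderiv ℝ (fderiv ℝ Γ) x z u v w - fderiv ℝ (fderiv ℝ Γ) x z v u w
      + (fderiv ℝ Γ x z u (Γ x v w) + Γ x u (fderiv ℝ Γ x z v w))
      - (fderiv ℝ Γ x z v (Γ x u w) + Γ x v (fderiv ℝ Γ x z u w))
      = fderiv ℝ P x z v w • u - fderiv ℝ P x z u w • v := by
  have hD : ContDiffOn ℝ ∞ (fderiv ℝ Γ) Ω := h.contDiffOn.fderiv_of_isOpen h.isOpen (by simp)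
  have hD2 : ∀ a b c : E, HasDerivAt (fun t : ℝ => fderiv ℝ Γ (x + t • z) a b c)
      (fderiv ℝ (fderiv ℝ Γ) x z a b c) 0 := fun a b c =>
    hasDerivAt_clm_apply_const (hasDerivAt_clm_apply_const (hasDerivAt_clm_apply_const
      (hasDerivAt_comp_line_zero (ContDiffOn.hasFDerivAt_of_isOpen hD h.isOpen hx) z) a) b) c
  have hG : ∀ a : E, HasDerivAt (fun t : ℝ => Γ (x + t • z) a) (fderiv ℝ Γ x z a) 0 := fun a =>
    hasDerivAt_clm_apply_const (hasDerivAt_comp_line_zero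
      (ContDiffOn.hasFDerivAt_of_isOpen h.contDiffOn h.isOpen hx) z) a
  have hGG : ∀ a b c : E, HasDerivAt (fun t : ℝ => Γ (x + t • z) a (Γ (x + t • z) b c))
      (fderiv ℝ Γ x z a (Γ x b c) + Γ x a (fderiv ℝ Γ x z b c)) 0 := fun a b c => by
    simpa using (hG a).clm_apply (h.hasDerivAt hx z b c)
  exact hasDerivAt_line_unique h.isOpen hx z
    (f := fun y => fderiv ℝ Γ y u v w - fderiv ℝ Γ y v u w + Γ y u (Γ y v w) - Γ y v (Γ y u w))
    (g := fun y => P y v w • u - P y u w • v)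
    (fun y hy => h.curvature y hy u v w)
    ((((hD2 u v w).sub (hD2 v u w)).add (hGG u v w)).sub (hGG v u w))
    (((h.hasDerivAt_schouten hx z v w).smul_const u).sub
      ((h.hasDerivAt_schouten hx z u w).smul_const v))

/-- The second Bianchi identity gives the Codazzi equation of the Schouten tensor. -/
lemma IsProjectivelyFlat.codazzi (h : IsProjectivelyFlat Γ P Ω) (hE : HasTransversals E)
    {x : E} (hx : x ∈ Ω) (u v w : E) :
    fderiv ℝ P x v u w - fderiv ℝ P x u v w = P x u (Γ x v w) - P x v (Γ x u w) := by
  obtain ⟨z, ℓ, hz, hu, hv⟩ := hE u v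
  have s : ∀ a b c : E,
      fderiv ℝ (fderiv ℝ Γ) x a b c w = fderiv ℝ (fderiv ℝ Γ) x b a c w := fun a b c => by
    rw [ContDiffOn.fderiv_fderiv_symm h.contDiffOn h.isOpen hx a b]
  have c : ∀ a b y, ℓ (fderiv ℝ Γ x a b y) - ℓ (fderiv ℝ Γ x b a y) + ℓ (Γ x a (Γ x b y))
      - ℓ (Γ x b (Γ x a y)) = P x b y * ℓ a - P x a y * ℓ b := fun a b y => by
    simpa using congrArg ℓ (h.curvature x hx a b y)
  have c' : ∀ d a b, ℓ (Γ x d (fderiv ℝ Γ x a b w)) - ℓ (Γ x d (fderiv ℝ Γ x b a w))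
      + ℓ (Γ x d (Γ x a (Γ x b w))) - ℓ (Γ x d (Γ x b (Γ x a w)))
      = P x b w * ℓ (Γ x d a) - P x a w * ℓ (Γ x d b) := fun d a b => by
    simpa using congrArg (fun y => ℓ (Γ x d y)) (h.curvature x hx a b w)
  have f : ∀ d a b, ℓ (fderiv ℝ (fderiv ℝ Γ) x d a b w) - ℓ (fderiv ℝ (fderiv ℝ Γ) x d b a w)
      + (ℓ (fderiv ℝ Γ x d a (Γ x b w)) + ℓ (Γ x a (fderiv ℝ Γ x d b w)))
      - (ℓ (fderiv ℝ Γ x d b (Γ x a w)) + ℓ (Γ x b (fderiv ℝ Γ x d a w)))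
      = fderiv ℝ P x d b w * ℓ a - fderiv ℝ P x d a w * ℓ b := fun d a b => by
    simpa using congrArg ℓ (h.fderiv_curvature hx d a b w)
  -- In the cyclic sum the second derivatives of `Γ` cancel by symmetry. The `c` and `d` identities
  -- (curvature applied to `Γ`, and `Γ` applied to curvature) account for the remaining products of
  -- `Γ` with its derivative.
  have f1 := f z u v
  have f2 := f u v z
  have f3 := f v z u
  rw [s z u v, s z v u] at f1
  rw [s u v z] at f2
  have c1 := c z u (Γ x v w)
  have c2 := c u v (Γ x z w)
  have c3 := c v z (Γ x u w)
  have d1 := c' v z u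
  have d2 := c' z u v
  have d3 := c' u v z
  rw [h.symm x hx v z, h.symm x hx v u] at d1
  rw [h.symm x hx z u] at d2
  simp only [hz, hu, hv] at f1 f2 f3 c1 c2 c3
  linarith

end Projective

/-! ### Prolongation of the Hessian equation and projective coordinates -/

section Prolongation

variable {E G : Type*} [NormedAddCommGroup E] [NormedSpace ℝ E] [FiniteDimensional ℝ E]
  [NormedAddCommGroup G] [NormedSpace ℝ G] [FiniteDimensional ℝ G]

/-- The connection form of the prolongation of the equation `∇∇f + f P = 0` for a `G`-valued
function `f`, acting on the pairs `(f, df)`. -/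
noncomputable def prolongation (γ : E →L[ℝ] E →L[ℝ] E) (p : E →L[ℝ] E →L[ℝ] ℝ) :
    E →L[ℝ] (G × (E →L[ℝ] G)) →L[ℝ] (G × (E →L[ℝ] G)) :=
  LinearMap.toContinuousLinearMap
    ((LinearMap.toContinuousLinearMap (𝕜 := ℝ) (E := G × (E →L[ℝ] G))
      (F' := G × (E →L[ℝ] G))).toLinearMap ∘ₗ
      LinearMap.mk₂ ℝ (fun u F => (F.2 u, F.2 ∘L γ u - (p u).smulRight F.1))
        (fun u u' F => by ext <;> simp [add_smul]; abel)
        (fun c u F => by ext <;> simp [mul_smul, smul_sub])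
        (fun u F F' => by ext <;> simp; abel)
        (fun c u F => by ext <;> simp [smul_sub, smul_smul, mul_comm]))

lemma prolongation_apply (γ : E →L[ℝ] E →L[ℝ] E) (p : E →L[ℝ] E →L[ℝ] ℝ) (u : E)
    (F : G × (E →L[ℝ] G)) :
    prolongation γ p u F = (F.2 u, F.2 ∘L γ u - (p u).smulRight F.1) := rfl

variable {Γ : E → E →L[ℝ] E →L[ℝ] E} {P : E → E →L[ℝ] E →L[ℝ] ℝ} {Ω : Set E}

lemma IsProjectivelyFlat.contDiffOn_prolongation (h : IsProjectivelyFlat Γ P Ω) :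
    ContDiffOn ℝ ∞ (fun x => prolongation (G := G) (Γ x) (P x)) Ω := by
  refine contDiffOn_clm_apply.2 fun u => contDiffOn_clm_apply.2 fun F => ?_
  simp only [prolongation_apply]
  refine contDiffOn_const.prodMk (contDiffOn_clm_apply.2 fun v => ?_)
  have h1 : ContDiffOn ℝ ∞ (fun x => Γ x u v) Ω :=
    (h.contDiffOn.clm_apply contDiffOn_const).clm_apply contDiffOn_const
  have h2 : ContDiffOn ℝ ∞ (fun x => P x u v) Ω :=
    (h.contDiffOn_schouten.clm_apply contDiffOn_const).clm_apply contDiffOn_const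
  exact (F.2.contDiff.comp_contDiffOn h1).sub (h2.smul contDiffOn_const)

/-- Only the second component depends on the base point, through `Γ` and `P`. -/
lemma IsProjectivelyFlat.fderiv_prolongation (h : IsProjectivelyFlat Γ P Ω) {x : E} (hx : x ∈ Ω)
    (u v : E) (F : G × (E →L[ℝ] G)) :
    (fderiv ℝ (fun x => prolongation (G := G) (Γ x) (P x)) x u v F).1 = 0 ∧
    ∀ w, (fderiv ℝ (fun x => prolongation (G := G) (Γ x) (P x)) x u v F).2 w =
      F.2 (fderiv ℝ Γ x u v w) - fderiv ℝ P x u v w • F.1 := by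
  have hd := hasDerivAt_clm_apply_const (hasDerivAt_clm_apply_const (hasDerivAt_comp_line_zero
    (ContDiffOn.hasFDerivAt_of_isOpen (h.contDiffOn_prolongation (G := G)) h.isOpen hx) u) v) F
  constructor
  · have h1 := (ContinuousLinearMap.fst ℝ G (E →L[ℝ] G)).hasFDerivAt.comp_hasDerivAt 0 hd
    exact h1.unique (hasDerivAt_const 0 (F.2 v))
  · intro w
    have h1 := hasDerivAt_clm_apply_const
      ((ContinuousLinearMap.snd ℝ G (E →L[ℝ] G)).hasFDerivAt.comp_hasDerivAt 0 hd) w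
    exact h1.unique ((F.2.hasFDerivAt.comp_hasDerivAt 0 (h.hasDerivAt hx u v w)).sub
      ((h.hasDerivAt_schouten hx u v w).smul_const F.1))

/-- Local solvability of `∇∇f + f P = 0` with arbitrary initial value and differential. -/
theorem IsProjectivelyFlat.exists_hessian_solution (h : IsProjectivelyFlat Γ P Ω)
    (hE : HasTransversals E) {x₀ : E} (hx₀ : x₀ ∈ Ω) (f₀ : G) (μ₀ : E →L[ℝ] G) :
    ∃ f : E → G, f x₀ = f₀ ∧ fderiv ℝ f x₀ = μ₀ ∧ ∃ r > 0, ball x₀ r ⊆ Ω ∧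
      ContDiffOn ℝ ∞ f (ball x₀ r) ∧ ∀ y ∈ ball x₀ r, ∀ u v,
        fderiv ℝ (fderiv ℝ f) y u v = fderiv ℝ f y (Γ y u v) - P y u v • f y := by
  obtain ⟨F, hF0, r, hr, hsub, hF⟩ := exists_hasFDerivAt_of_flat h.isOpen
    (h.contDiffOn_prolongation (G := G)) (V := G × (E →L[ℝ] G)) (fun x hx u v F => by
      obtain ⟨a1, a2⟩ := h.fderiv_prolongation hx u v F
      obtain ⟨b1, b2⟩ := h.fderiv_prolongation hx v u F
      refine Prod.ext ?_ ?_
      -- The first component of the curvature vanishes by symmetry of `Γ` and `P`; the second is the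
      -- curvature equation under `F.2` plus the Codazzi equation times `F.1`.
      · simp only [Prod.fst_add, Prod.fst_sub, a1, b1, prolongation_apply]
        simp [h.symm x hx u v, h.schouten_symm hE hx u v]
      · ext w
        have hc := congrArg F.2 (h.curvature x hx u v w)
        have hz := h.codazzi hE hx u v w
        simp only [map_add, map_sub, map_smul] at hc
        simp only [Prod.snd_add, Prod.snd_sub, _root_.add_apply, _root_.sub_apply, a2, b2,
          prolongation_apply]
        simp
        linear_combination (norm := module) hc + hz • F.1) hx₀ (f₀, μ₀)
  have hFs := contDiffOn_of_hasFDerivAt isOpen_ball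
    ((h.contDiffOn_prolongation (G := G)).mono hsub) hF
  have h1 : ∀ y ∈ ball x₀ r, HasFDerivAt (fun x => (F x).1) (F y).2 y := fun y hy => by
    exact (ContinuousLinearMap.fst ℝ G (E →L[ℝ] G)).hasFDerivAt.comp y (hF y hy)
  have hx : x₀ ∈ ball x₀ r := mem_ball_self hr
  refine ⟨fun x => (F x).1, by simp only [hF0], by rw [(h1 x₀ hx).fderiv, hF0], r, hr, hsub,
    contDiff_fst.comp_contDiffOn hFs, fun y hy u v => ?_⟩
  have h2 : HasFDerivAt (fun x => (F x).2) _ y :=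
    (ContinuousLinearMap.snd ℝ G (E →L[ℝ] G)).hasFDerivAt.comp y (hF y hy)
  have h3 : fderiv ℝ (fun x => (F x).1) =ᶠ[𝓝 y] fun x => (F x).2 := by
    filter_upwards [isOpen_ball.mem_nhds hy] with z hz using (h1 z hz).fderiv
  rw [h3.fderiv_eq, h2.fderiv, (h1 y hy).fderiv]
  simp [prolongation_apply]

/-- Existence of coordinates `Φ` in which the geodesics are straight lines: the quotient of
solutions of `∇∇f + f P = 0`. -/
theorem IsProjectivelyFlat.exists_projective_coordinates (h : IsProjectivelyFlat Γ P Ω)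
    (hE : HasTransversals E) {x₀ : E} (hx₀ : x₀ ∈ Ω) (L : E →L[ℝ] E) :
    ∃ (Φ : E → E) (lam : E → E →L[ℝ] ℝ), fderiv ℝ Φ x₀ = L ∧ ∃ r > 0, ball x₀ r ⊆ Ω ∧
      ContDiffOn ℝ ∞ Φ (ball x₀ r) ∧ ∀ y ∈ ball x₀ r, ∀ u v,
        fderiv ℝ (fderiv ℝ Φ) y u v =
          fderiv ℝ Φ y (Γ y u v) - lam y u • fderiv ℝ Φ y v - lam y v • fderiv ℝ Φ y u := by
  -- The initial data make `g` nonzero near `x₀` and give `f/g` the differential `L` there.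
  obtain ⟨g, hg0, hg1, r₁, hr₁, hsub₁, hgs, hgh⟩ := h.exists_hessian_solution hE hx₀ (1 : ℝ) 0
  obtain ⟨f, hf0, hf1, r₂, hr₂, hsub₂, hfs, hfh⟩ := h.exists_hessian_solution hE hx₀ (0 : E) L
  have hg : ∀ᶠ y in 𝓝 x₀, g y ≠ 0 :=
    (hgs.continuousOn.continuousAt (isOpen_ball.mem_nhds (mem_ball_self hr₁))).eventually_ne
      (by simp [hg0])
  obtain ⟨r₃, hr₃, hball⟩ := Metric.eventually_nhds_iff_ball.1 hg
  set r := min r₁ (min r₂ r₃)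
  have hr : 0 < r := lt_min hr₁ (lt_min hr₂ hr₃)
  have i1 : ball x₀ r ⊆ ball x₀ r₁ := ball_subset_ball (min_le_left _ _)
  have i2 : ball x₀ r ⊆ ball x₀ r₂ :=
    ball_subset_ball ((min_le_right _ _).trans (min_le_left _ _))
  have i3 : ball x₀ r ⊆ ball x₀ r₃ :=
    ball_subset_ball ((min_le_right _ _).trans (min_le_right _ _))
  have hg' : ∀ y ∈ ball x₀ r, g y ≠ 0 := fun y hy => hball y (i3 hy)
  have hgs' := hgs.mono i1
  have hΦs : ContDiffOn ℝ ∞ (fun y => (g y)⁻¹ • f y) (ball x₀ r) :=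
    (hgs'.inv hg').smul (hfs.mono i2)
  set Φ : E → E := fun y => (g y)⁻¹ • f y
  have hfΦ : ∀ y ∈ ball x₀ r, f y = g y • Φ y := fun y hy => by
    simp [Φ, smul_smul, mul_inv_cancel₀ (hg' y hy)]
  have hdg : ∀ y ∈ ball x₀ r, HasFDerivAt g (fderiv ℝ g y) y := fun y hy =>
    ContDiffOn.hasFDerivAt_of_isOpen hgs' isOpen_ball hy
  have hdΦ : ∀ y ∈ ball x₀ r, HasFDerivAt Φ (fderiv ℝ Φ y) y := fun y hy =>
    ContDiffOn.hasFDerivAt_of_isOpen hΦs isOpen_ball hy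
  have hdf : ∀ y ∈ ball x₀ r, ∀ v,
      fderiv ℝ f y v = g y • fderiv ℝ Φ y v + fderiv ℝ g y v • Φ y := fun y hy v => by
    have h1 := ((hdg y hy).smul (hdΦ y hy)).congr_of_eventuallyEq (f₁ := f) (by
      filter_upwards [isOpen_ball.mem_nhds hy] with z hz using hfΦ z hz)
    rw [h1.fderiv]
    simp
  have hx : x₀ ∈ ball x₀ r := mem_ball_self hr
  refine ⟨Φ, fun y => (g y)⁻¹ • fderiv ℝ g y, ?_, r, hr, i1.trans hsub₁, hΦs, fun y hy u v => ?_⟩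
  · ext1 v
    have := hdf x₀ hx v
    simpa [hf1, hg0, hg1] using this.symm
  have hgd : HasFDerivAt (fderiv ℝ g) _ y := ContDiffOn.hasFDerivAt_of_isOpen
    (hgs'.fderiv_of_isOpen isOpen_ball (by simp)) isOpen_ball hy
  have hΦd : HasFDerivAt (fderiv ℝ Φ) _ y := ContDiffOn.hasFDerivAt_of_isOpen
    (hΦs.fderiv_of_isOpen isOpen_ball (by simp)) isOpen_ball hy
  have hfd : HasFDerivAt (fderiv ℝ f) _ y := ContDiffOn.hasFDerivAt_of_isOpen
    ((hfs.mono i2).fderiv_of_isOpen isOpen_ball (by simp)) isOpen_ball hy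
  have l1 := hasDerivAt_comp_line_zero (hdg y hy) u
  have l2 := hasDerivAt_comp_line_zero (hdΦ y hy) u
  have l3 := hasDerivAt_clm_apply_const (hasDerivAt_comp_line_zero hgd u) v
  have l4 := hasDerivAt_clm_apply_const (hasDerivAt_comp_line_zero hΦd u) v
  have l5 := hasDerivAt_clm_apply_const (hasDerivAt_comp_line_zero hfd u) v
  -- The second derivative of `f = g Φ`, computed twice. Since `f` and `g` solve the same equation,
  -- the terms in `P` drop out and division by `g` leaves `λ = dg/g`.
  have key := hasDerivAt_line_unique isOpen_ball hy u (f := fun y => fderiv ℝ f y v)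
    (g := fun y => g y • fderiv ℝ Φ y v + fderiv ℝ g y v • Φ y) (fun y hy => hdf y hy v) l5
    ((l1.smul l4).add (l3.smul l2))
  rw [hfh y (i2 hy), hgh y (i1 hy), hdf y hy, hfΦ y hy] at key
  simp only [zero_smul, add_zero, smul_eq_mul] at key
  simp only [_root_.smul_apply, smul_eq_mul]
  refine smul_right_injective E (hg' y hy) ?_
  simp only [smul_sub, smul_smul, mul_inv_cancel_left₀ (hg' y hy)]
  linear_combination (norm := module) -key

end Prolongation

/-! ### Alternating forms on `ℝⁿ` and forms with skew derivative -/

section Alternating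

variable {n : ℕ}

/-- The standard basis vectors of `ℝⁿ`. -/
noncomputable abbrev stdVec (i : Fin n) : Rn n := EuclideanSpace.single i (1 : ℝ)

lemma sum_smul_stdVec (v : Rn n) : ∑ i, v i • stdVec i = v := by
  simpa using (EuclideanSpace.basisFun (Fin n) ℝ).sum_repr v

/-- Evaluation of a form on the tuples of standard basis vectors. -/
noncomputable def formComponents (n p : ℕ) :
    (Rn n [⋀^Fin p]→L[ℝ] ℝ) →ₗ[ℝ] ((Fin p → Fin n) → ℝ) where
  toFun T i := T fun j => stdVec (i j)
  map_add' _ _ := rfl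
  map_smul' _ _ := rfl

lemma form_ext {p : ℕ} {T T' : Rn n [⋀^Fin p]→L[ℝ] ℝ}
    (h : ∀ i : Fin p → Fin n, T (fun j => stdVec (i j)) = T' fun j => stdVec (i j)) : T = T' := by
  apply ContinuousAlternatingMap.toAlternatingMap_injective
  refine Module.Basis.ext_alternating (EuclideanSpace.basisFun (Fin n) ℝ).toBasis fun i _ => ?_
  simpa using h i

lemma formComponents_injective (n p : ℕ) : Function.Injective (formComponents n p) :=
  fun _ _ h => form_ext fun i => congrFun h i

instance (n p : ℕ) : FiniteDimensional ℝ (Rn n [⋀^Fin p]→L[ℝ] ℝ) :=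
  FiniteDimensional.of_injective _ (formComponents_injective n p)

/-- A family of forms is smooth if its components are. -/
lemma contDiffOn_form {F : Type*} [NormedAddCommGroup F] [NormedSpace ℝ F] {p : ℕ}
    {T : F → Rn n [⋀^Fin p]→L[ℝ] ℝ} {s : Set F}
    (h : ∀ v : Fin p → Rn n, ContDiffOn ℝ ∞ (fun y => T y v) s) : ContDiffOn ℝ ∞ T s := by
  obtain ⟨g, hg⟩ := (formComponents n p).exists_leftInverse_of_injective
    (LinearMap.ker_eq_bot.2 (formComponents_injective n p))
  have h1 : ContDiffOn ℝ ∞ (fun y => formComponents n p (T y)) s :=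
    contDiffOn_pi.2 fun i => h fun j => stdVec (i j)
  have h2 := (LinearMap.toContinuousLinearMap g).contDiff.comp_contDiffOn h1 (n := ∞)
  exact h2.congr fun y _ => (LinearMap.congr_fun hg (T y)).symm

/-- A skew-symmetric array is the array of components of a form. -/
lemma exists_form_of_isSkew {q : ℕ} {C : (Fin q → Fin n) → ℝ} (hC : IsSkew C) :
    ∃ T : Rn n [⋀^Fin q]→L[ℝ] ℝ, ∀ i : Fin q → Fin n, T (fun j => stdVec (i j)) = C i := by
  -- The sum runs over all index tuples, so no factor `1/q!` is needed to recover `C i` on basis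
  -- vectors.
  let m : MultilinearMap ℝ (fun _ : Fin q => Rn n) ℝ := ∑ i : Fin q → Fin n,
    C i • (MultilinearMap.mkPiAlgebra ℝ (Fin q) ℝ).compLinearMap
      fun j => (EuclideanSpace.proj (i j) : Rn n →L[ℝ] ℝ).toLinearMap
  have hm : ∀ v, m v = ∑ i : Fin q → Fin n, C i * ∏ j, v j (i j) := fun v => by
    simp [m]
  have halt : ∀ (v : Fin q → Rn n) (a b : Fin q), v a = v b → a ≠ b → m v = 0 := by
    intro v a b hv hab
    rw [hm]
    have hs : ∀ i : Fin q → Fin n, C (i ∘ Equiv.swap a b) = - C i := fun i => by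
      rw [hC, Equiv.Perm.sign_swap hab]; simp
    -- Tuples exchanged by the transposition cancel in pairs; a fixed tuple has `C i = -C i`, hence
    -- contributes nothing.
    refine Finset.sum_involution (fun i _ => i ∘ Equiv.swap a b) (fun i _ => ?_)
      (fun i _ hi hii => ?_)
      (fun _ _ => Finset.mem_univ _) (fun i _ => ?_)
    · have : ∏ j, v j ((i ∘ Equiv.swap a b) j) = ∏ j, v j (i j) := by
        rw [← Equiv.prod_comp (Equiv.swap a b)]
        refine Finset.prod_congr rfl fun j _ => ?_
        have : v (Equiv.swap a b j) = v j := by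
          by_cases h1 : j = a
          · subst h1; simp [hv]
          · by_cases h2 : j = b
            · subst h2; simp [hv]
            · rw [Equiv.swap_apply_of_ne_of_ne h1 h2]
        simp [this]
      rw [this, hs]
      ring
    · have := hs i
      rw [hii] at this
      have h0 : C i = 0 := by linarith
      exact hi (by rw [h0, zero_mul])
    · ext j; simp
  let mA : AlternatingMap ℝ (Rn n) ℝ (Fin q) := { m with map_eq_zero_of_eq' := halt }
  have hcont : Continuous m := by
    have : (m : (Fin q → Rn n) → ℝ) = fun v => ∑ i : Fin q → Fin n, C i * ∏ j, v j (i j) :=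
      funext hm
    rw [this]
    fun_prop
  refine ⟨{ mA with cont := hcont }, fun i => ?_⟩
  change m _ = _
  rw [hm, Finset.sum_eq_single i]
  · simp
  · intro k _ hk
    obtain ⟨j, hj⟩ := Function.ne_iff.1 hk
    rw [Finset.prod_eq_zero (Finset.mem_univ j), mul_zero]
    simp [hj]
  · simp

/-- The exterior product of a linear form with a `p`-form. -/
lemma exists_wedge {E : Type*} [NormedAddCommGroup E] [NormedSpace ℝ E] {p : ℕ} (lam : E →L[ℝ] ℝ)
    (τ : E [⋀^Fin p]→L[ℝ] ℝ) :
    ∃ κ : E [⋀^Fin (p + 1)]→L[ℝ] ℝ, ∀ (u : E) (v : Fin p → E), κ (Fin.cons u v) =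
      lam u * τ v - ∑ j, lam (v j) * τ (Function.update v j u) := by
  refine ⟨ContinuousAlternatingMap.alternatizeUncurryFin (lam.smulRight τ), fun u v => ?_⟩
  rw [ContinuousAlternatingMap.alternatizeUncurryFin_apply, Fin.sum_univ_succ, sub_eq_add_neg,
    ← Finset.sum_neg_distrib]
  congr 1
  · simp
  refine Finset.sum_congr rfl fun j _ => ?_
  obtain ⟨k, rfl⟩ : ∃ k, p = k + 1 := ⟨p - 1, by have := j.pos; omega⟩
  -- Position `j + 1` carries the sign `(-1)^(j+1)`, and moving `u` into slot `j` costs `(-1)^j`: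
  -- together `-1` for every `j`.
  have h1 : Fin.removeNth j.succ (Fin.cons u v : Fin (k + 2) → E)
      = Matrix.vecCons u (j.removeNth v) := by
    ext1 i
    refine Fin.cases ?_ (fun i => ?_) i
    · simp [Fin.removeNth]
    · simp [Fin.removeNth, Fin.succ_succAbove_succ]
  rw [h1, ← Fin.insertNth_removeNth, ContinuousAlternatingMap.map_insertNth]
  simp [pow_succ]
  ring

lemma map_cons_swap {E : Type*} [NormedAddCommGroup E] [NormedSpace ℝ E] {p : ℕ}
    (β : E [⋀^Fin (p + 1)]→L[ℝ] ℝ) (u : E) (v : Fin p → E) (j : Fin p) :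
    β (Fin.cons (v j) (Function.update v j u)) = - β (Fin.cons u v) := by
  have hs : β ((Fin.cons u v : Fin (p + 1) → E) ∘ Equiv.swap 0 j.succ) = - β (Fin.cons u v) :=
    β.toAlternatingMap.map_swap (Fin.cons u v) (Fin.succ_ne_zero j).symm
  rw [← hs]
  congr 1
  ext1 i
  refine Fin.cases ?_ (fun i => ?_) i
  · simp
  · by_cases h : i = j
    · subst h; simp
    · simp [Function.comp, h, Equiv.swap_apply_of_ne_of_ne (Fin.succ_ne_zero i)
        (fun hh => h (Fin.succ_injective _ hh))]

lemma isSkew_components {q : ℕ} (β : Rn n [⋀^Fin q]→L[ℝ] ℝ) :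
    IsSkew fun i : Fin q → Fin n => β fun j => stdVec (i j) := fun σ i => by
  have := β.toAlternatingMap.map_perm (fun j => stdVec (i j)) σ
  simpa [Units.smul_def, Function.comp_def] using this

/-- On a convex open set of a vector space with its flat connection, a form whose derivative is
totally skew is affine. -/
lemma exists_affine_of_fderiv_skew {E : Type*} [NormedAddCommGroup E] [NormedSpace ℝ E] {p : ℕ}
    (hp : 1 ≤ p) {τ : E → E [⋀^Fin p]→L[ℝ] ℝ} {B : Set E} (hB : IsOpen B) (hBc : IsPreconnected B)
    (hτ : ContDiffOn ℝ ∞ τ B)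
    (hskew : ∀ y ∈ B, ∃ β : E [⋀^Fin (p + 1)]→L[ℝ] ℝ, ∀ u v,
      fderiv ℝ τ y u v = β (Fin.cons u v)) {y₀ : E} (hy₀ : y₀ ∈ B) {y : E} (hy : y ∈ B) :
    τ y = τ y₀ + fderiv ℝ τ y₀ (y - y₀) := by
  have hD : ContDiffOn ℝ ∞ (fderiv ℝ τ) B := hτ.fderiv_of_isOpen hB (by simp)
  have hD2 : ∀ z ∈ B, fderiv ℝ (fderiv ℝ τ) z = 0 := by
    intro z hz
    have hder : ∀ (w u : E) (v : Fin p → E), HasDerivAt (fun t : ℝ => fderiv ℝ τ (z + t • w) u v)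
        (fderiv ℝ (fderiv ℝ τ) z w u v) 0 := fun w u v => by
      have := hasDerivAt_clm_apply_const
        (hasDerivAt_comp_line_zero (ContDiffOn.hasFDerivAt_of_isOpen hD hB hz) w) u
      exact (ContinuousAlternatingMap.apply ℝ E ℝ v).hasFDerivAt.comp_hasDerivAt 0 this
    have hsw : ∀ w u v (j : Fin p), fderiv ℝ (fderiv ℝ τ) z w (v j) (Function.update v j u) =
        - fderiv ℝ (fderiv ℝ τ) z w u v := fun w u v j =>
      hasDerivAt_line_unique hB hz w (f := fun y => fderiv ℝ τ y (v j) (Function.update v j u))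
        (g := fun y => - fderiv ℝ τ y u v) (fun y hy => by
          obtain ⟨β, hβ⟩ := hskew y hy
          rw [hβ, hβ, map_cons_swap]) (hder _ _ _) (hder _ _ _).neg
    have hsym := ContDiffOn.fderiv_fderiv_symm hτ hB hz
    ext w u v
    -- As `p ≥ 1` there is a slot to exchange with the direction of differentiation. An expression
    -- in `(a, b, c)` symmetric in `a, b` and skew in `b, c` changes sign after six such exchanges
    -- returning to the start, so it is zero.
    set j : Fin p := ⟨0, hp⟩
    have h2 : ∀ a b c : E, fderiv ℝ (fderiv ℝ τ) z a b (Function.update v j c) =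
        - fderiv ℝ (fderiv ℝ τ) z a c (Function.update v j b) := fun a b c => by
      have := hsw a c (Function.update v j b) j
      rw [← this]; simp
    have h1 : ∀ a b c : E, fderiv ℝ (fderiv ℝ τ) z a b (Function.update v j c) =
        fderiv ℝ (fderiv ℝ τ) z b a (Function.update v j c) := fun a b c => by rw [hsym]
    have := h1 w u (v j)
    have := h2 u w (v j)
    have := h1 u (v j) w
    have := h2 (v j) u w
    have := h1 (v j) w u
    have := h2 w (v j) u
    rw [Function.update_eq_self] at *
    simp
    linarith
  have hDc : ∀ z ∈ B, fderiv ℝ τ z = fderiv ℝ τ y₀ := fun z hz =>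
    hB.is_const_of_fderiv_eq_zero hBc (hD.differentiableOn (by simp)) hD2 hz hy₀
  have hd : ∀ z ∈ B, HasFDerivAt (fun z => τ z - fderiv ℝ τ y₀ z) 0 z := fun z hz => by
    have := (ContDiffOn.hasFDerivAt_of_isOpen hτ hB hz).sub (fderiv ℝ τ y₀).hasFDerivAt
    rwa [hDc z hz, sub_self] at this
  have := hB.is_const_of_fderiv_eq_zero hBc
    (fun z hz => (hd z hz).differentiableAt.differentiableWithinAt)
    (fun z hz => (hd z hz).fderiv) hy hy₀
  rw [map_sub]
  rw [sub_eq_iff_eq_add] at this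
  rw [this]
  abel

/-- Two vectors span a proper subspace. Here `n > 2` is essential; the other steps need only `n >
1`. -/
lemma hasTransversals_rn (hn : 2 < n) : HasTransversals (Rn n) := by
  intro u v
  have hlt : Submodule.span ℝ (Set.range ![u, v]) ≠ ⊤ := fun h => by
    have h1 := finrank_range_le_card (R := ℝ) ![u, v]
    rw [Set.finrank, h, finrank_top, finrank_euclideanSpace] at h1
    simp at h1
    omega
  obtain ⟨ℓ, hℓ, hker⟩ := Submodule.exists_le_ker_of_lt_top _ (lt_top_iff_ne_top.2 hlt)
  obtain ⟨z, hz⟩ : ∃ z, ℓ z ≠ 0 := by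
    by_contra! h
    exact hℓ (LinearMap.ext h)
  refine ⟨(ℓ z)⁻¹ • z, LinearMap.toContinuousLinearMap ℓ, ?_, ?_, ?_⟩
  · simp [hz]
  · exact hker (Submodule.subset_span ⟨0, rfl⟩)
  · exact hker (Submodule.subset_span ⟨1, rfl⟩)

end Alternating

/-! ### Vector fields and connections read in a chart -/

section Chart

variable {n : ℕ} {M : Type*} [TopologicalSpace M] [ChartedSpace (Rn n) M]

/-- The derivative of a chart. -/
noncomputable def chartDeriv (φ : OpenPartialHomeomorph M (Rn n)) (x : M) :
    Tangent n x →L[ℝ] Rn n :=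
  mfderiv 𝓘(ℝ, Rn n) 𝓘(ℝ, Rn n) φ x

/-- The inverse of the derivative of a chart. -/
noncomputable def chartInv (φ : OpenPartialHomeomorph M (Rn n)) (x : M) :
    Rn n →L[ℝ] Tangent n x :=
  ContinuousLinearMap.inverse (chartDeriv φ x)

/-- The field with constant components `v` in a chart. -/
noncomputable def constField (φ : OpenPartialHomeomorph M (Rn n)) (v : Rn n) : VField n M :=
  fun x => chartInv φ x v

/-- The components of a vector field in a chart, as a function of the coordinates. -/
noncomputable def inChart (φ : OpenPartialHomeomorph M (Rn n)) (Y : VField n M) (y : Rn n) :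
    Rn n :=
  chartDeriv φ (φ.symm y) (Y (φ.symm y))

variable [IsManifold 𝓘(ℝ, Rn n) ∞ M]
variable {φ : OpenPartialHomeomorph M (Rn n)}

theorem mdifferentiable_of_mem_atlas (hφ : φ ∈ IsManifold.maximalAtlas 𝓘(ℝ, Rn n) ∞ M) :
    φ.MDifferentiable 𝓘(ℝ, Rn n) 𝓘(ℝ, Rn n) :=
  ⟨(contMDiffOn_of_mem_maximalAtlas hφ).mdifferentiableOn (by simp),
    (contMDiffOn_symm_of_mem_maximalAtlas hφ).mdifferentiableOn (by simp)⟩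

theorem isInvertible_chartDeriv (hφ : φ ∈ IsManifold.maximalAtlas 𝓘(ℝ, Rn n) ∞ M)
    {x : M} (hx : x ∈ φ.source) :
    (chartDeriv φ x).IsInvertible :=
  ⟨(mdifferentiable_of_mem_atlas hφ).mfderiv hx, rfl⟩

theorem chartDeriv_chartInv (hφ : φ ∈ IsManifold.maximalAtlas 𝓘(ℝ, Rn n) ∞ M)
    {x : M} (hx : x ∈ φ.source) (v : Rn n) :
    chartDeriv φ x (chartInv φ x v) = v :=
  (isInvertible_chartDeriv hφ hx).self_apply_inverse v

theorem chartInv_chartDeriv (hφ : φ ∈ IsManifold.maximalAtlas 𝓘(ℝ, Rn n) ∞ M)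
    {x : M} (hx : x ∈ φ.source) (v : Tangent n x) :
    chartInv φ x (chartDeriv φ x v) = v :=
  (isInvertible_chartDeriv hφ hx).inverse_apply_self v

theorem inChart_apply {x : M} (hx : x ∈ φ.source) (Y : VField n M) :
    inChart φ Y (φ x) = chartDeriv φ x (Y x) := by
  rw [inChart, φ.left_inv hx]

theorem inChart_constField (hφ : φ ∈ IsManifold.maximalAtlas 𝓘(ℝ, Rn n) ∞ M)
    {y : Rn n} (hy : y ∈ φ.target) (v : Rn n) :
    inChart φ (constField φ v) y = v :=
  chartDeriv_chartInv hφ (φ.map_target hy) v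

theorem isInvertible_mfderiv_symm (hφ : φ ∈ IsManifold.maximalAtlas 𝓘(ℝ, Rn n) ∞ M)
    {y : Rn n} (hy : y ∈ φ.target) :
    (mfderiv 𝓘(ℝ, Rn n) 𝓘(ℝ, Rn n) φ.symm y).IsInvertible :=
  ⟨(mdifferentiable_of_mem_atlas hφ).symm.mfderiv hy, rfl⟩

theorem inChart_eq_mpullback (hφ : φ ∈ IsManifold.maximalAtlas 𝓘(ℝ, Rn n) ∞ M)
    {y : Rn n} (hy : y ∈ φ.target) (Y : VField n M) :
    VectorField.mpullback 𝓘(ℝ, Rn n) 𝓘(ℝ, Rn n) φ.symm Y y = inChart φ Y y := by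
  have h := ContinuousLinearMap.inverse_equiv ((mdifferentiable_of_mem_atlas hφ).symm.mfderiv hy)
  exact congrArg (fun L => L (Y (φ.symm y))) h

theorem smoothFieldAt_constField (hφ : φ ∈ IsManifold.maximalAtlas 𝓘(ℝ, Rn n) ∞ M)
    {x : M} (hx : x ∈ φ.source) (v : Rn n) :
    SmoothFieldAt (constField φ v) x := by
  refine ContMDiffAt.mpullback_vectorField_preimage (n := ∞) (V := fun _ => v) ?_
    (contMDiffAt_of_mem_maximalAtlas hφ hx) (isInvertible_chartDeriv hφ hx) le_rfl
  exact contMDiffAt_vectorSpace_iff_contDiffAt.2 contDiffAt_const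

theorem SmoothFieldAt.contDiffAt_inChart (hφ : φ ∈ IsManifold.maximalAtlas 𝓘(ℝ, Rn n) ∞ M)
    {y : Rn n} (hy : y ∈ φ.target)
    {Y : VField n M} (hY : SmoothFieldAt Y (φ.symm y)) : ContDiffAt ℝ ∞ (inChart φ Y) y := by
  have h := ContMDiffAt.mpullback_vectorField_preimage hY
    (contMDiffAt_symm_of_mem_maximalAtlas hφ hy) (isInvertible_mfderiv_symm hφ hy) le_rfl
  refine (contMDiffAt_vectorSpace_iff_contDiffAt.1 h).congr_of_eventuallyEq ?_
  filter_upwards [φ.open_target.mem_nhds hy] with z hz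
  exact (inChart_eq_mpullback hφ hz Y).symm

theorem SmoothFieldAt.mdifferentiableAt {Y : VField n M} {x : M} (hY : SmoothFieldAt Y x) :
    MDifferentiableAt 𝓘(ℝ, Rn n) (𝓘(ℝ, Rn n)).tangent
      (fun y => (⟨y, Y y⟩ : TangentBundle 𝓘(ℝ, Rn n) M)) x :=
  ContMDiffAt.mdifferentiableAt hY (by simp)

theorem differentiableAt_inChart (hφ : φ ∈ IsManifold.maximalAtlas 𝓘(ℝ, Rn n) ∞ M)
    {y : Rn n} (hy : y ∈ φ.target)
    {Y : VField n M} (hY : MDifferentiableAt 𝓘(ℝ, Rn n) (𝓘(ℝ, Rn n)).tangent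
      (fun y => (⟨y, Y y⟩ : TangentBundle 𝓘(ℝ, Rn n) M)) (φ.symm y)) :
    DifferentiableAt ℝ (inChart φ Y) y := by
  have h := MDifferentiableAt.mpullback_vectorField (n := ∞) hY
    (contMDiffAt_symm_of_mem_maximalAtlas hφ hy) (isInvertible_mfderiv_symm hφ hy)
    (WithTop.coe_le_coe.2 (le_top : (2:ℕ∞) ≤ ⊤))
  have h' := (((contMDiff_snd_tangentBundle_modelSpace (Rn n) 𝓘(ℝ, Rn n)
    (n := 1)).contMDiffAt.mdifferentiableAt one_ne_zero).comp y h).differentiableAt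
  refine h'.congr_of_eventuallyEq ?_
  filter_upwards [φ.open_target.mem_nhds hy] with z hz
  exact (inChart_eq_mpullback hφ hz Y).symm

theorem mvfderiv_eq_fderiv (hφ : φ ∈ IsManifold.maximalAtlas 𝓘(ℝ, Rn n) ∞ M)
    {x : M} (hx : x ∈ φ.source) {g : M → ℝ}
    (hg : MDifferentiableAt 𝓘(ℝ, Rn n) 𝓘(ℝ, ℝ) g x) :
    DifferentiableAt ℝ (g ∘ φ.symm) (φ x) ∧ ∀ w : Tangent n x,
      mvfderiv 𝓘(ℝ, Rn n) g x w = fderiv ℝ (g ∘ φ.symm) (φ x) (chartDeriv φ x w) := by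
  have hs := (contMDiffAt_symm_of_mem_maximalAtlas hφ (φ.map_source hx)).mdifferentiableAt
    (by simp : (∞ : WithTop ℕ∞) ≠ 0)
  have hg' : MDifferentiableAt 𝓘(ℝ, Rn n) 𝓘(ℝ, ℝ) g (φ.symm (φ x)) := by rwa [φ.left_inv hx]
  have hG : DifferentiableAt ℝ (g ∘ φ.symm) (φ x) :=
    mdifferentiableAt_iff_differentiableAt.1 (hg'.comp _ hs)
  refine ⟨hG, fun w => ?_⟩
  have hev : g =ᶠ[𝓝 x] (g ∘ φ.symm) ∘ φ := by
    filter_upwards [φ.open_source.mem_nhds hx] with z hz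
    simp [φ.left_inv hz]
  have h := mfderiv_comp x (mdifferentiableAt_iff_differentiableAt.2 hG)
    ((mdifferentiable_of_mem_atlas hφ).mdifferentiableAt hx)
  rw [← hev.mfderiv_eq, mfderiv_eq_fderiv] at h
  exact congrArg (fun L => L w) h

/-- The flat connection of a chart. -/
noncomputable def flatCov (φ : OpenPartialHomeomorph M (Rn n)) (Y : VField n M) (x : M) :
    Tangent n x →L[ℝ] Tangent n x :=
  (chartInv φ x).comp ((fderiv ℝ (inChart φ Y) (φ x)).comp (chartDeriv φ x))

/-- The flat connection is the reference from which `∇` differs by a tensor on the chart domain. -/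
theorem isCovariantDerivativeOn_flatCov (hφ : φ ∈ IsManifold.maximalAtlas 𝓘(ℝ, Rn n) ∞ M) :
    IsCovariantDerivativeOn (I := 𝓘(ℝ, Rn n)) (Rn n) (flatCov (M := M) φ) φ.source where
  add {Y Z x} hY hZ hx := by
    have hx' : φ.symm (φ x) = x := φ.left_inv hx
    have hY' := differentiableAt_inChart hφ (φ.map_source hx) (Y := Y) (by rwa [hx'])
    have hZ' := differentiableAt_inChart hφ (φ.map_source hx) (Y := Z) (by rwa [hx'])
    have h : inChart φ (Y + Z) = inChart φ Y + inChart φ Z := by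
      funext y; exact map_add (chartDeriv φ (φ.symm y)) _ _
    ext1 w
    simp only [flatCov, h, fderiv_add hY' hZ']
    exact map_add (chartInv φ x) _ _
  leibniz {Y g x} hY hg hx := by
    have hx' : φ.symm (φ x) = x := φ.left_inv hx
    have hY' := differentiableAt_inChart hφ (φ.map_source hx) (Y := Y) (by rwa [hx'])
    obtain ⟨hG, hw⟩ := mvfderiv_eq_fderiv hφ hx hg
    have h : inChart φ (g • Y) = (g ∘ φ.symm) • inChart φ Y := by
      funext y; exact map_smul (chartDeriv φ (φ.symm y)) _ _
    ext1 w
    simp only [flatCov, h, fderiv_smul hG hY']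
    have h2 := hw w
    have h3 : inChart φ Y (φ x) = chartDeriv φ x (Y x) := inChart_apply hx Y
    have h4 := chartInv_chartDeriv hφ hx (Y x)
    change chartInv φ x ((g ∘ φ.symm) (φ x) • fderiv ℝ (inChart φ Y) (φ x) (chartDeriv φ x w) +
      (fderiv ℝ (g ∘ φ.symm) (φ x) (chartDeriv φ x w)) • inChart φ Y (φ x)) =
      g x • chartInv φ x (fderiv ℝ (inChart φ Y) (φ x) (chartDeriv φ x w)) +
        mvfderiv 𝓘(ℝ, Rn n) g x w • Y x
    rw [h2, h3, map_add, map_smul, map_smul, h4, Function.comp_apply, hx']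

/-- `Γ` is the family of Christoffel symbols of the connection `cov` in the chart `φ`. -/
def IsChristoffel (cov : Connection n M) (φ : OpenPartialHomeomorph M (Rn n))
    (Γ : Rn n → Rn n →L[ℝ] Rn n →L[ℝ] Rn n) : Prop :=
  ∀ y ∈ φ.target, ∀ (Y : VField n M), MDifferentiableAt 𝓘(ℝ, Rn n) (𝓘(ℝ, Rn n)).tangent
      (fun y => (⟨y, Y y⟩ : TangentBundle 𝓘(ℝ, Rn n) M)) (φ.symm y) → ∀ w,
    chartDeriv φ (φ.symm y) (cov Y (φ.symm y) w) =
      fderiv ℝ (inChart φ Y) y (chartDeriv φ (φ.symm y) w) +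
        Γ y (chartDeriv φ (φ.symm y) w) (inChart φ Y y)

/-- The difference of two covariant derivatives is tensorial; transported by the chart, it is `Γ`.
-/
theorem exists_isChristoffel (cov : Connection n M)
    (hφ : φ ∈ IsManifold.maximalAtlas 𝓘(ℝ, Rn n) ∞ M) :
    ∃ Γ, IsChristoffel cov φ Γ := by
  have hc : IsCovariantDerivativeOn (I := 𝓘(ℝ, Rn n)) (Rn n) cov.toFun φ.source :=
    cov.isCovariantDerivativeOn
  let D := hc.difference (isCovariantDerivativeOn_flatCov hφ)
  let Γ : Rn n → Rn n →L[ℝ] Rn n →L[ℝ] Rn n := fun y =>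
    LinearMap.toContinuousLinearMap
      ((LinearMap.toContinuousLinearMap : (Rn n →ₗ[ℝ] Rn n) ≃ₗ[ℝ] _).toLinearMap ∘ₗ
        LinearMap.mk₂ ℝ (fun u v => chartDeriv φ (φ.symm y)
          (D (φ.symm y) (chartInv φ (φ.symm y) v) (chartInv φ (φ.symm y) u)))
          (fun u u' v => by simp) (fun c u v => by simp) (fun u v v' => by simp)
          (fun c u v => by simp))
  refine ⟨Γ, fun y hy Y hY w => ?_⟩
  have hx := φ.map_target hy
  have h := congrArg (fun L => L w) (IsCovariantDerivativeOn.difference_apply hc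
    (isCovariantDerivativeOn_flatCov hφ) hx hY)
  have h1 : Γ y (chartDeriv φ (φ.symm y) w) (inChart φ Y y) = chartDeriv φ (φ.symm y)
      (D (φ.symm y) (Y (φ.symm y)) w) := by
    change chartDeriv φ (φ.symm y) (D (φ.symm y) (chartInv φ (φ.symm y)
      (chartDeriv φ (φ.symm y) (Y (φ.symm y))))
      (chartInv φ (φ.symm y) (chartDeriv φ (φ.symm y) w))) = _
    rw [chartInv_chartDeriv hφ hx, chartInv_chartDeriv hφ hx]
  have h2 : D (φ.symm y) (Y (φ.symm y)) w = cov Y (φ.symm y) w - chartInv φ (φ.symm y)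
      (fderiv ℝ (inChart φ Y) (φ (φ.symm y)) (chartDeriv φ (φ.symm y) w)) := h
  rw [h1, h2, map_sub, chartDeriv_chartInv hφ hx, φ.right_inv hy]
  abel

end Chart

/-! ### Smoothness, symmetry and curvature in terms of Christoffel symbols -/

section Christoffel

variable {n : ℕ} {M : Type*} [TopologicalSpace M] [ChartedSpace (Rn n) M]
  [IsManifold 𝓘(ℝ, Rn n) ∞ M]
variable {φ : OpenPartialHomeomorph M (Rn n)}
  {cov : Connection n M} {Γ : Rn n → Rn n →L[ℝ] Rn n →L[ℝ] Rn n}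

theorem IsChristoffel.inChart_nabla (hΓ : IsChristoffel cov φ Γ) {y : Rn n} (hy : y ∈ φ.target)
    (X : VField n M) {Y : VField n M} (hY : SmoothFieldAt Y (φ.symm y)) :
    inChart φ (nabla cov X Y) y =
      fderiv ℝ (inChart φ Y) y (inChart φ X y) + Γ y (inChart φ X y) (inChart φ Y y) :=
  hΓ y hy Y hY.mdifferentiableAt _

theorem fderiv_inChart_constField (hφ : φ ∈ IsManifold.maximalAtlas 𝓘(ℝ, Rn n) ∞ M)
    {y : Rn n} (hy : y ∈ φ.target) (v : Rn n) :
    fderiv ℝ (inChart φ (constField φ v)) y = 0 := by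
  have h : inChart φ (constField φ v) =ᶠ[𝓝 y] fun _ => v := by
    filter_upwards [φ.open_target.mem_nhds hy] with z hz
    exact inChart_constField hφ hz v
  rw [h.fderiv_eq]; simp

theorem IsChristoffel.inChart_nabla_constField (hΓ : IsChristoffel cov φ Γ)
    (hφ : φ ∈ IsManifold.maximalAtlas 𝓘(ℝ, Rn n) ∞ M) {y : Rn n} (hy : y ∈ φ.target) (u v : Rn n) :
    inChart φ (nabla cov (constField φ u) (constField φ v)) y = Γ y u v := by
  rw [hΓ.inChart_nabla hy _ (smoothFieldAt_constField hφ (φ.map_target hy) v),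
    fderiv_inChart_constField hφ hy, inChart_constField hφ hy, inChart_constField hφ hy]
  simp

/-- Smoothness of the connection is applied to a globally smooth field, so `Y` is first cut off by a
bump function. The cut-off does not change `nabla cov X Y` near `x`, by locality. -/
theorem smoothFieldAt_nabla [T2Space M]
    (hcov : CovariantDerivative.ContMDiffCovariantDerivative cov ∞) {U : Set M} (hU : IsOpen U)
    {x : M} (hx : x ∈ U) {X Y : VField n M} (hX : SmoothFieldAt X x)
    (hY : ∀ z ∈ U, SmoothFieldAt Y z) : SmoothFieldAt (nabla cov X Y) x := by
  obtain ⟨f, -, hf⟩ := ((SmoothBumpFunction.nhds_basis_tsupport (I := 𝓘(ℝ, Rn n)) x).mem_iff).1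
    (hU.mem_nhds hx)
  have hfY : ContMDiff 𝓘(ℝ, Rn n) (𝓘(ℝ, Rn n)).tangent ∞
      (fun y => (⟨y, ((f : M → ℝ) • Y) y⟩ : TangentBundle 𝓘(ℝ, Rn n) M)) :=
    ContMDiffOn.smul_section_of_tsupport f.contMDiff.contMDiffOn hU hf
      (fun z hz => (hY z hz).contMDiffWithinAt)
  have h := hcov.contMDiff.contMDiff (σ := (f : M → ℝ) • Y) hfY.contMDiffOn
  have h2 := ContMDiffAt.clm_bundle_apply (h.contMDiffAt univ_mem) hX
  refine h2.congr_of_eventuallyEq ?_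
  filter_upwards [f.eventuallyEq_one.eventually_nhds, hU.mem_nhds hx] with z hz hzU
  have h3 : cov ((f : M → ℝ) • Y) z = cov Y z := by
    refine cov.isCovariantDerivativeOnUniv.congr_of_eventuallyEq
      (hfY.contMDiffAt.mdifferentiableAt (by simp)) (hY z hzU).mdifferentiableAt univ_mem ?_
    filter_upwards [hz] with w hw
    have : f w = 1 := hw
    change f w • Y w = Y w
    rw [this, one_smul]
  exact congrArg (fun L => (⟨z, L (X z)⟩ : TangentBundle 𝓘(ℝ, Rn n) M)) h3.symm

theorem contDiffOn_clm₂ {F : Type*} [NormedAddCommGroup F] [NormedSpace ℝ F]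
    {T : Rn n → Rn n →L[ℝ] Rn n →L[ℝ] F} {s : Set (Rn n)}
    (h : ∀ u v, ContDiffOn ℝ ∞ (fun y => T y u v) s) : ContDiffOn ℝ ∞ T s :=
  contDiffOn_clm_apply.2 fun u => contDiffOn_clm_apply.2 fun v => h u v

theorem IsChristoffel.contDiffOn [T2Space M] (hΓ : IsChristoffel cov φ Γ)
    (hcov : CovariantDerivative.ContMDiffCovariantDerivative cov ∞)
    (hφ : φ ∈ IsManifold.maximalAtlas 𝓘(ℝ, Rn n) ∞ M) :
    ContDiffOn ℝ ∞ Γ φ.target := by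
  refine contDiffOn_clm₂ fun u v y hy => ContDiffAt.contDiffWithinAt ?_
  have h := SmoothFieldAt.contDiffAt_inChart hφ hy (smoothFieldAt_nabla hcov φ.open_source
    (φ.map_target hy) (smoothFieldAt_constField hφ (φ.map_target hy) u)
    (fun z hz => smoothFieldAt_constField hφ hz v))
  refine h.congr_of_eventuallyEq ?_
  filter_upwards [φ.open_target.mem_nhds hy] with z hz
  exact (hΓ.inChart_nabla_constField hφ hz u v).symm

/-- Lie brackets commute with pullback, and constant fields on `ℝⁿ` commute. -/
theorem mlieBracket_constField (hφ : φ ∈ IsManifold.maximalAtlas 𝓘(ℝ, Rn n) ∞ M)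
    {x : M} (hx : x ∈ φ.source) (u v : Rn n) :
    VectorField.mlieBracket 𝓘(ℝ, Rn n) (constField φ u) (constField φ v) x = 0 := by
  have hc (u : Rn n) : MDifferentiableAt 𝓘(ℝ, Rn n) (𝓘(ℝ, Rn n)).tangent
      (fun y => (⟨y, u⟩ : TangentBundle 𝓘(ℝ, Rn n) (Rn n))) (φ x) :=
    (contMDiffAt_vectorSpace_iff_contDiffAt (n := 1) (V := fun _ => u) |>.2
      contDiffAt_const).mdifferentiableAt one_ne_zero
  have : IsManifold 𝓘(ℝ, Rn n) (minSmoothness ℝ 2) M := by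
    rw [minSmoothness_of_isRCLikeNormedField]
    exact IsManifold.of_le (n := ∞) (WithTop.coe_le_coe.2 (le_top : (2:ℕ∞) ≤ ⊤))
  have h := VectorField.mpullback_mlieBracket (V := fun _ => u) (W := fun _ => v) (n := ∞)
    (hc u) (hc v) (contMDiffAt_of_mem_maximalAtlas hφ hx)
    (by rw [minSmoothness_of_isRCLikeNormedField]
        exact WithTop.coe_le_coe.2 (le_top : (2:ℕ∞) ≤ ⊤))
  refine h.symm.trans ?_
  have h1 (V W : (x : Rn n) → TangentSpace 𝓘(ℝ, Rn n) x) :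
      VectorField.mlieBracket 𝓘(ℝ, Rn n) V W = VectorField.lieBracket ℝ V W := by
    rw [← VectorField.mlieBracketWithin_univ, VectorField.mlieBracketWithin_eq_lieBracketWithin]
    exact VectorField.lieBracketWithin_univ
  have h0 : VectorField.mlieBracket 𝓘(ℝ, Rn n) (fun _ : Rn n => u) (fun _ => v) = 0 := by
    refine (h1 _ _).trans ?_
    funext y
    simp only [VectorField.lieBracket_eq, fderiv_fun_const, Pi.zero_apply, _root_.zero_apply,
      sub_zero]
    rfl
  rw [h0, VectorField.mpullback_zero]; rfl

theorem IsChristoffel.symm (hΓ : IsChristoffel cov φ Γ)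
    (htor : CovariantDerivative.torsion cov = 0) (hφ : φ ∈ IsManifold.maximalAtlas 𝓘(ℝ, Rn n) ∞ M)
    {y : Rn n} (hy : y ∈ φ.target)
    (u v : Rn n) : Γ y u v = Γ y v u := by
  have hx := φ.map_target hy
  have h := (CovariantDerivative.torsion_eq_zero_iff cov).1 htor
    (smoothFieldAt_constField hφ hx u).mdifferentiableAt
    (smoothFieldAt_constField hφ hx v).mdifferentiableAt
  rw [mlieBracket_constField hφ hx] at h
  rw [← hΓ.inChart_nabla_constField hφ hy, ← hΓ.inChart_nabla_constField hφ hy]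
  exact congrArg _ (sub_eq_zero.1 h)

theorem IsChristoffel.chartDeriv_curvature [T2Space M] (hΓ : IsChristoffel cov φ Γ)
    (hcov : CovariantDerivative.ContMDiffCovariantDerivative cov ∞)
    (hφ : φ ∈ IsManifold.maximalAtlas 𝓘(ℝ, Rn n) ∞ M)
    {y : Rn n} (hy : y ∈ φ.target) (u v w : Rn n) :
    chartDeriv φ (φ.symm y)
      (curvature cov (constField φ u) (constField φ v) (constField φ w) (φ.symm y)) =
      fderiv ℝ Γ y u v w - fderiv ℝ Γ y v u w + Γ y u (Γ y v w) - Γ y v (Γ y u w) := by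
  have hx := φ.map_target hy
  have key (u v : Rn n) : inChart φ (nabla cov (constField φ u)
      (nabla cov (constField φ v) (constField φ w))) y =
      fderiv ℝ Γ y u v w + Γ y u (Γ y v w) := by
    have hs : SmoothFieldAt (nabla cov (constField φ v) (constField φ w)) (φ.symm y) :=
      smoothFieldAt_nabla hcov φ.open_source hx (smoothFieldAt_constField hφ hx v)
        (fun z hz => smoothFieldAt_constField hφ hz w)
    rw [hΓ.inChart_nabla hy _ hs, inChart_constField hφ hy, hΓ.inChart_nabla_constField hφ hy]
    have h : inChart φ (nabla cov (constField φ v) (constField φ w)) =ᶠ[𝓝 y]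
        fun z => Γ z v w := by
      filter_upwards [φ.open_target.mem_nhds hy] with z hz
      exact hΓ.inChart_nabla_constField hφ hz v w
    have hd := ContDiffOn.hasFDerivAt_of_isOpen (hΓ.contDiffOn hcov hφ) φ.open_target hy
    have hd2 := (hd.clm_apply (hasFDerivAt_const v y)).clm_apply (hasFDerivAt_const w y)
    rw [h.fderiv_eq, hd2.fderiv]
    simp
  have h3 : nabla cov (VectorField.mlieBracket 𝓘(ℝ, Rn n) (constField φ u) (constField φ v))
      (constField φ w) (φ.symm y) = 0 := by
    rw [nabla, mlieBracket_constField hφ hx]; exact map_zero _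
  have h4 : curvature cov (constField φ u) (constField φ v) (constField φ w) (φ.symm y) =
    nabla cov (constField φ u) (nabla cov (constField φ v) (constField φ w)) (φ.symm y) -
    nabla cov (constField φ v) (nabla cov (constField φ u) (constField φ w)) (φ.symm y) - 0 := by
    rw [← h3]; rfl
  rw [h4, sub_zero, map_sub]
  change inChart φ _ y - inChart φ _ y = _
  rw [key, key]
  abel

set_option linter.unusedSimpArgs false in
theorem exists_isProjectivelyFlat [T2Space M] (hn : 1 < n) (hΓ : IsChristoffel cov φ Γ)
    (hcov : CovariantDerivative.ContMDiffCovariantDerivative cov ∞)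
    (htor : CovariantDerivative.torsion cov = 0) (hproj : IsEquiprojective cov)
    (hφ : φ ∈ IsManifold.maximalAtlas 𝓘(ℝ, Rn n) ∞ M) : ∃ P, IsProjectivelyFlat Γ P φ.target := by
  have hsm := hΓ.contDiffOn hcov hφ
  have hn0 : 0 < n := by omega
  set K : Rn n → Rn n → Rn n → Rn n → Rn n := fun y u v w =>
    fderiv ℝ Γ y u v w - fderiv ℝ Γ y v u w + Γ y u (Γ y v w) - Γ y v (Γ y u w) with hK
  -- Here `p` is a bare function: `ricci` is computed with local extensions, so neither its
  -- bilinearity nor its smoothness is apparent.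
  have hKp : ∀ y ∈ φ.target, ∃ p : Rn n → Rn n → ℝ, ∀ u v w,
      K y u v w = p v w • u - p u w • v := by
    intro y hy
    have hx := φ.map_target hy
    refine ⟨fun v w => ((n : ℝ) - 1)⁻¹ *
      ricci cov (φ.symm y) (chartInv φ (φ.symm y) v) (chartInv φ (φ.symm y) w), fun u v w => ?_⟩
    have h := hproj (φ.symm y) _ _ _ (smoothFieldAt_constField hφ hx u)
      (smoothFieldAt_constField hφ hx v) (smoothFieldAt_constField hφ hx w)
    rw [hK]
    dsimp only
    rw [← hΓ.chartDeriv_curvature hcov hφ hy, h, map_smul, map_sub, map_smul, map_smul]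
    simp only [constField, chartDeriv_chartInv hφ hx, smul_sub, smul_smul]
  -- `P` is redefined as a normalised trace of the coordinate curvature `K`, which is visibly
  -- bilinear and smooth; it remains to see that it agrees with `p`.
  let P : Rn n → Rn n →L[ℝ] Rn n →L[ℝ] ℝ := fun y =>
    LinearMap.toContinuousLinearMap
      ((LinearMap.toContinuousLinearMap : (Rn n →ₗ[ℝ] ℝ) ≃ₗ[ℝ] _).toLinearMap ∘ₗ
        LinearMap.mk₂ ℝ (fun v w => ((n : ℝ) - 1)⁻¹ * ∑ i, (K y (stdVec i) v w) i)
          (by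
            intros
            simp only [hK, map_add, map_smul, _root_.add_apply, _root_.smul_apply,
              PiLp.add_apply, PiLp.sub_apply, PiLp.smul_apply, smul_eq_mul, Finset.mul_sum,
              ← Finset.sum_add_distrib]
            refine Finset.sum_congr rfl fun i _ => ?_
            ring)
          (by
            intros
            simp only [hK, map_add, map_smul, _root_.add_apply, _root_.smul_apply,
              PiLp.add_apply, PiLp.sub_apply, PiLp.smul_apply, smul_eq_mul, Finset.mul_sum,
              ← Finset.sum_add_distrib]
            refine Finset.sum_congr rfl fun i _ => ?_
            ring)
          (by
            intros
            simp only [hK, map_add, map_smul, _root_.add_apply, _root_.smul_apply,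
              PiLp.add_apply, PiLp.sub_apply, PiLp.smul_apply, smul_eq_mul, Finset.mul_sum,
              ← Finset.sum_add_distrib]
            refine Finset.sum_congr rfl fun i _ => ?_
            ring)
          (by
            intros
            simp only [hK, map_add, map_smul, _root_.add_apply, _root_.smul_apply,
              PiLp.add_apply, PiLp.sub_apply, PiLp.smul_apply, smul_eq_mul, Finset.mul_sum,
              ← Finset.sum_add_distrib]
            refine Finset.sum_congr rfl fun i _ => ?_
            ring))
  have hP : ∀ y v w, P y v w = ((n : ℝ) - 1)⁻¹ * ∑ i, (K y (stdVec i) v w) i := fun _ _ _ => rfl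
  refine ⟨P, φ.open_target, hsm, contDiffOn_clm₂ fun v w => ?_, fun y hy u v =>
    hΓ.symm htor hφ hy u v, fun y hy u v w => ?_⟩
  · simp only [hP, hK]
    have hd := hsm.fderiv_of_isOpen (m := ∞) φ.open_target le_rfl
    have hcst (v : Rn n) : ContDiffOn ℝ ∞ (fun _ : Rn n => v) φ.target := contDiffOn_const
    refine contDiffOn_const.mul (ContDiffOn.sum fun i _ => ?_)
    have hco : ContDiff ℝ ∞ (fun z : Rn n => z i) := by fun_prop
    refine hco.comp_contDiffOn ?_
    refine (((((hd.clm_apply (hcst _)).clm_apply (hcst _)).clm_apply (hcst _)).sub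
      (((hd.clm_apply (hcst _)).clm_apply (hcst _)).clm_apply (hcst _))).add
      ((hsm.clm_apply (hcst _)).clm_apply ((hsm.clm_apply (hcst _)).clm_apply (hcst _)))).sub
      ((hsm.clm_apply (hcst _)).clm_apply ((hsm.clm_apply (hcst _)).clm_apply (hcst _)))
  · obtain ⟨p, hp⟩ := hKp y hy
    suffices h : ∀ v w, P y v w = p v w by
      rw [h, h, ← hp]
    intro v w
    have hz : stdVec (⟨0, hn0⟩ : Fin n) ≠ 0 := by
      intro h; simpa using congrArg (fun z : Rn n => z ⟨0, hn0⟩) h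
    -- Linearity of `p` in its first slot is inherited from `K`, by comparing coefficients of a
    -- fixed nonzero basis vector. The trace is then `n p(v,w) - p(v,w)`, whence the factor
    -- `(n-1)⁻¹`.
    have hlin : ∑ i, v i * p (stdVec i) w = p v w := by
      have h1 : K y v (stdVec ⟨0, hn0⟩) w = ∑ i, v i • K y (stdVec i) (stdVec ⟨0, hn0⟩) w := by
        conv_lhs => rw [← sum_smul_stdVec v]
        simp only [hK, map_sum, map_smul, _root_.sum_apply, _root_.smul_apply, smul_sub, smul_add,
          Finset.sum_sub_distrib, Finset.sum_add_distrib]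
      simp only [hp, smul_sub, Finset.sum_sub_distrib] at h1
      have h5 : ∑ i, v i • p (stdVec ⟨0, hn0⟩) w • (stdVec i : Rn n) =
          p (stdVec ⟨0, hn0⟩) w • v := by
        rw [Finset.sum_congr rfl fun i _ => smul_comm _ _ _, ← Finset.smul_sum, sum_smul_stdVec]
      have h6 : (∑ i, v i * p (stdVec i) w) • (stdVec ⟨0, hn0⟩ : Rn n) =
          p v w • stdVec ⟨0, hn0⟩ := by
        rw [Finset.sum_smul]
        simp only [mul_smul]
        linear_combination (norm := module) h1 + h5
      exact smul_left_injective ℝ hz h6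
    rw [hP]
    simp only [hp, PiLp.sub_apply, PiLp.smul_apply, smul_eq_mul, Finset.sum_sub_distrib]
    have h2 : ∑ i, p v w * (stdVec i : Rn n) i = n * p v w := by simp
    have h3 : ∑ i, p (stdVec i) w * v i = p v w := by rw [← hlin]; simp [mul_comm]
    have h4 : (n : ℝ) - 1 ≠ 0 := by
      have : (1 : ℝ) < n := by exact_mod_cast hn
      linarith
    rw [h2, h3]
    field_simp

end Christoffel

/-! ### Differential forms and their covariant derivative in a chart -/

section Forms

variable {n p : ℕ} {M : Type*} [TopologicalSpace M] [ChartedSpace (Rn n) M]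

/-- The components of a form in a chart, as a function of the coordinates. -/
noncomputable def formInChart (φ : OpenPartialHomeomorph M (Rn n)) (θ : FormField n M p)
    (y : Rn n) : Rn n [⋀^Fin p]→L[ℝ] ℝ :=
  (θ (φ.symm y)).compContinuousLinearMap (chartInv φ (φ.symm y))

/-- The form with given components in a chart. -/
noncomputable def formOfChart (φ : OpenPartialHomeomorph M (Rn n))
    (T : Rn n → Rn n [⋀^Fin p]→L[ℝ] ℝ) : FormField n M p :=
  fun x => (T (φ x)).compContinuousLinearMap (chartDeriv φ x)

variable [IsManifold 𝓘(ℝ, Rn n) ∞ M]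
variable {φ : OpenPartialHomeomorph M (Rn n)}
  {cov : Connection n M} {Γ : Rn n → Rn n →L[ℝ] Rn n →L[ℝ] Rn n}

theorem formInChart_apply (φ : OpenPartialHomeomorph M (Rn n)) (θ : FormField n M p)
    (y : Rn n) (v : Fin p → Rn n) :
    formInChart φ θ y v = θ (φ.symm y) (fun j => constField φ (v j) (φ.symm y)) := rfl

theorem form_apply_eq (hφ : φ ∈ IsManifold.maximalAtlas 𝓘(ℝ, Rn n) ∞ M)
    {x : M} (hx : x ∈ φ.source) (θ : FormField n M p)
    (Y : Fin p → Tangent n x) :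
    θ x Y = formInChart φ θ (φ x) (fun j => chartDeriv φ x (Y j)) := by
  -- `φ.symm (φ x)` equals `x` only propositionally; generalising the base point allows substitution
  -- in the dependent types.
  have h : ∀ x', x' = x → ∀ Y' : Fin p → Tangent n x, θ x' (fun j => chartInv φ x'
    (chartDeriv φ x (Y' j))) = θ x Y' := by
    rintro x' rfl Y'
    simp only [chartInv_chartDeriv hφ hx]
  exact (h _ (φ.left_inv hx) Y).symm

theorem formInChart_formOfChart (hφ : φ ∈ IsManifold.maximalAtlas 𝓘(ℝ, Rn n) ∞ M)
    {y : Rn n} (hy : y ∈ φ.target)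
    (T : Rn n → Rn n [⋀^Fin p]→L[ℝ] ℝ) : formInChart φ (formOfChart φ T) y = T y := by
  ext v
  change T (φ (φ.symm y)) (fun j => chartDeriv φ (φ.symm y) (chartInv φ (φ.symm y) (v j))) = _
  simp only [chartDeriv_chartInv hφ (φ.map_target hy), φ.right_inv hy]

theorem component_eq {x : M} (hx : x ∈ φ.source) (θ : FormField n M p) (i : Fin p → Fin n) :
    component φ θ i x = formInChart φ θ (φ x) (fun j => stdVec (i j)) := by
  rw [formInChart_apply, φ.left_inv hx]; rfl

theorem contDiffOn_formInChart (hφ : φ ∈ IsManifold.maximalAtlas 𝓘(ℝ, Rn n) ∞ M)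
    {θ : FormField n M p}
    (hθ : SmoothFormOn θ φ.source) : ContDiffOn ℝ ∞ (formInChart φ θ) φ.target := by
  refine contDiffOn_form fun v y hy => ContDiffAt.contDiffWithinAt ?_
  have hx := φ.map_target hy
  have h := hθ _ hx (fun j => constField φ (v j)) fun j => smoothFieldAt_constField hφ hx (v j)
  exact (h.comp y (contMDiffAt_symm_of_mem_maximalAtlas hφ hy)).contDiffAt

theorem smoothFormOn_formOfChart (hφ : φ ∈ IsManifold.maximalAtlas 𝓘(ℝ, Rn n) ∞ M)
    {T : Rn n → Rn n [⋀^Fin p]→L[ℝ] ℝ}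
    (hT : ContDiffOn ℝ ∞ T φ.target) : SmoothFormOn (formOfChart φ T) φ.source := by
  intro x hx Y hY
  have hy := φ.map_source hx
  have hY' : ∀ j, ContDiffAt ℝ ∞ (inChart φ (Y j)) (φ x) := fun j =>
    SmoothFieldAt.contDiffAt_inChart hφ hy (by rw [φ.left_inv hx]; exact hY j)
  have h1 : ContDiffAt ℝ ∞ (fun z => T z (fun j => inChart φ (Y j) z)) (φ x) := by
    have ha := (ContinuousLinearMap.analyticAt_uncurry_of_multilinear
      (ContinuousAlternatingMap.toContinuousMultilinearMapCLM ℝ :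
        (Rn n [⋀^Fin p]→L[ℝ] ℝ) →L[ℝ] _)
      (x := (T (φ x), fun j => inChart φ (Y j) (φ x)))).contDiffAt (n := ∞)
    exact ha.comp (φ x) ((hT.contDiffAt (φ.open_target.mem_nhds hy)).prodMk
      (contDiffAt_pi.2 hY'))
  refine (h1.contMDiffAt.comp x (contMDiffAt_of_mem_maximalAtlas hφ hx)).congr_of_eventuallyEq ?_
  filter_upwards [φ.open_source.mem_nhds hx] with z hz
  change T (φ z) _ = T (φ z) _
  simp only [inChart_apply hz]
  rfl

/-- By the product rule the derivatives of the components of the `Y j` cancel against those in `∇_X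
(Y j)`, leaving only Christoffel terms. -/
theorem IsChristoffel.nablaForm_eq (hΓ : IsChristoffel cov φ Γ)
    (hφ : φ ∈ IsManifold.maximalAtlas 𝓘(ℝ, Rn n) ∞ M)
    {θ : FormField n M p} (hθ : SmoothFormOn θ φ.source) {x : M} (hx : x ∈ φ.source)
    (X : VField n M) {Y : Fin p → VField n M} (hY : ∀ j, SmoothFieldAt (Y j) x) :
    nablaForm cov θ X Y x =
      fderiv ℝ (formInChart φ θ) (φ x) (chartDeriv φ x (X x))
        (fun j => chartDeriv φ x (Y j x)) -
      ∑ j, formInChart φ θ (φ x) (Function.update (fun j => chartDeriv φ x (Y j x)) j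
        (Γ (φ x) (chartDeriv φ x (X x)) (chartDeriv φ x (Y j x)))) := by
  have hy := φ.map_source hx
  have hY' : ∀ j, DifferentiableAt ℝ (inChart φ (Y j)) (φ x) := fun j =>
    (SmoothFieldAt.contDiffAt_inChart hφ hy (by rw [φ.left_inv hx]; exact hY j)).differentiableAt
      (by simp)
  have hT := (contDiffOn_formInChart hφ hθ).contDiffAt (φ.open_target.mem_nhds hy)
    |>.differentiableAt (by simp)
  have hg := (hθ x hx Y hY).mdifferentiableAt (by simp)
  have h1 : (fun y => θ y (fun i => Y i y)) ∘ φ.symm =ᶠ[𝓝 (φ x)]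
      fun z => formInChart φ θ z (fun j => inChart φ (Y j) z) := by
    filter_upwards [φ.open_target.mem_nhds hy] with z hz
    have h := form_apply_eq hφ (φ.map_target hz) θ (fun i => Y i (φ.symm z))
    rw [φ.right_inv hz] at h
    exact h
  rw [nablaForm, (mvfderiv_eq_fderiv hφ hx hg).2, h1.fderiv_eq,
    fderiv_continuousAlternatingMap_apply_apply hT hY', add_sub_assoc, sub_eq_add_neg]
  have h2 : (fun j => inChart φ (Y j) (φ x)) = fun j => chartDeriv φ x (Y j x) := by
    funext j; exact inChart_apply hx _
  rw [h2]
  congr 1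
  rw [← sub_eq_add_neg, ← Finset.sum_sub_distrib, ← Finset.sum_neg_distrib]
  refine Finset.sum_congr rfl fun j _ => ?_
  have h3 : chartDeriv φ x (nabla cov X (Y j) x) = fderiv ℝ (inChart φ (Y j)) (φ x)
      (chartDeriv φ x (X x)) + Γ (φ x) (chartDeriv φ x (X x)) (chartDeriv φ x (Y j x)) := by
    have := hΓ.inChart_nabla hy X (Y := Y j) (by rw [φ.left_inv hx]; exact hY j)
    rwa [inChart_apply hx, inChart_apply hx, inChart_apply hx] at this
  rw [form_apply_eq hφ hx θ]
  have h4 : (fun i => chartDeriv φ x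
      (Function.update (fun j => Y j x) j (nabla cov X (Y j) x) i)) =
      Function.update (fun j => chartDeriv φ x (Y j x)) j
        (chartDeriv φ x (nabla cov X (Y j) x)) := by
    funext i
    rcases eq_or_ne i j with rfl | h <;> simp [*]
  rw [h4, h3, ContinuousAlternatingMap.map_update_add]
  ring

end Forms

/-! ### Passage to projective coordinates -/

section ChangeOfChart

variable {n : ℕ} {M : Type*} [TopologicalSpace M] [ChartedSpace (Rn n) M]
  [IsManifold 𝓘(ℝ, Rn n) ∞ M]
variable {φ₀ φ : OpenPartialHomeomorph M (Rn n)}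
  {cov : Connection n M} {Γ₀ Γ : Rn n → Rn n →L[ℝ] Rn n →L[ℝ] Rn n}

/-- A chart can be restricted to an open part of its target. -/
theorem exists_restrict_target (hφ : φ ∈ IsManifold.maximalAtlas 𝓘(ℝ, Rn n) ∞ M)
    {O : Set (Rn n)} (hO : IsOpen O)
    (hsub : O ⊆ φ.target) :
    ∃ φ' ∈ IsManifold.maximalAtlas 𝓘(ℝ, Rn n) ∞ M, (⇑φ' = ⇑φ) ∧ φ'.target = O ∧
      (∀ {p : ℕ} (θ : FormField n M p), formInChart φ' θ = formInChart φ θ) ∧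
      φ'.source ⊆ φ.source ∧ ∀ x ∈ φ.source, φ x ∈ O → x ∈ φ'.source := by
  have ht : (φ.symm.restrOpen O hO).symm.target = O := by
    change φ.target ∩ O = O
    exact inter_eq_right.2 hsub
  have hs : (φ.symm.restrOpen O hO).symm.source ⊆ φ.source := fun x hx => hx.1
  refine ⟨(φ.symm.restrOpen O hO).symm, ?_, rfl, ht, fun _ => rfl, hs,
    fun x hx hxO => ⟨hx, hxO⟩⟩
  refine OpenPartialHomeomorph.mem_maximalAtlas_of_contMDiffOn _
    ((contMDiffOn_of_mem_maximalAtlas hφ).mono hs) ?_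
  rw [ht]
  exact (contMDiffOn_symm_of_mem_maximalAtlas hφ).mono hsub

/-- Composing a chart with a map having invertible derivative at a point gives a chart. -/
theorem exists_chart_comp (hφ₀ : φ₀ ∈ IsManifold.maximalAtlas 𝓘(ℝ, Rn n) ∞ M)
    {m : M} (hm : m ∈ φ₀.source) {Φ : Rn n → Rn n}
    {B : Set (Rn n)} (hB : IsOpen B) (hmB : φ₀ m ∈ B) (hΦ : ContDiffOn ℝ ∞ Φ B)
    {L : Rn n ≃L[ℝ] Rn n} (hL : fderiv ℝ Φ (φ₀ m) = L) :
    ∃ φ ∈ IsManifold.maximalAtlas 𝓘(ℝ, Rn n) ∞ M, m ∈ φ.source ∧ φ.source ⊆ φ₀.source ∧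
      ∀ x ∈ φ.source, φ₀ x ∈ B ∧ φ x = Φ (φ₀ x) := by
  have hd : HasFDerivAt Φ (L : Rn n →L[ℝ] Rn n) (φ₀ m) :=
    hL ▸ ContDiffOn.hasFDerivAt_of_isOpen hΦ hB hmB
  have hc : ContDiffAt ℝ ∞ Φ (φ₀ m) := hΦ.contDiffAt (hB.mem_nhds hmB)
  have h0 : (∞ : WithTop ℕ∞) ≠ 0 := by simp
  -- On `W` the differential is invertible at every point, so the local inverse is smooth on its
  -- whole domain and not just at the image of `m`.
  set W : Set (Rn n) := B ∩ fderiv ℝ Φ ⁻¹' range ((↑) : (Rn n ≃L[ℝ] Rn n) → Rn n →L[ℝ] Rn n)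
    with hW
  have hWo : IsOpen W := (hΦ.continuousOn_fderiv_of_isOpen hB (by simp)).isOpen_inter_preimage hB
    ContinuousLinearEquiv.isOpen
  have hmW : φ₀ m ∈ W := ⟨hmB, L, hL.symm⟩
  set g := (hc.toOpenPartialHomeomorph Φ hd h0).restrOpen W hWo with hg
  have hgΦ : ⇑g = Φ := rfl
  have hgs : g.source ⊆ W := fun z hz => hz.2
  have hgm : φ₀ m ∈ g.source := ⟨hc.mem_toOpenPartialHomeomorph_source hd h0, hmW⟩
  have hgsm : ContDiffOn ℝ ∞ g g.source := hΦ.mono fun z hz => (hgs hz).1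
  have hgsymm : ContDiffOn ℝ ∞ g.symm g.target := by
    intro z hz
    obtain ⟨hzB, L', hL'⟩ := hgs (g.map_target hz)
    refine (g.contDiffAt_symm hz (f₀' := L') ?_
      (hΦ.contDiffAt (hB.mem_nhds hzB))).contDiffWithinAt
    rw [hL']
    exact ContDiffOn.hasFDerivAt_of_isOpen hΦ hB hzB
  refine ⟨φ₀.trans g, ?_, ⟨hm, hgm⟩, fun x hx => hx.1, fun x hx => ⟨(hgs hx.2).1, rfl⟩⟩
  refine OpenPartialHomeomorph.mem_maximalAtlas_of_contMDiffOn _ ?_ ?_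
  · exact hgsm.contMDiffOn.comp ((contMDiffOn_of_mem_maximalAtlas hφ₀).mono fun x hx => hx.1)
      fun x hx => hx.2
  · exact (contMDiffOn_symm_of_mem_maximalAtlas hφ₀).comp
      (hgsymm.contMDiffOn.mono fun x hx => hx.1) fun x hx => hx.2

theorem chartDeriv_comp (hφ₀ : φ₀ ∈ IsManifold.maximalAtlas 𝓘(ℝ, Rn n) ∞ M)
    {Φ : Rn n → Rn n} {B : Set (Rn n)} (hB : IsOpen B)
    (hΦ : ContDiffOn ℝ ∞ Φ B) (hsub : φ.source ⊆ φ₀.source)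
    (hcomp : ∀ x ∈ φ.source, φ₀ x ∈ B ∧ φ x = Φ (φ₀ x)) {x : M} (hx : x ∈ φ.source)
    (w : Tangent n x) : chartDeriv φ x w = fderiv ℝ Φ (φ₀ x) (chartDeriv φ₀ x w) := by
  have hev : φ =ᶠ[𝓝 x] Φ ∘ φ₀ := by
    filter_upwards [φ.open_source.mem_nhds hx] with z hz using (hcomp z hz).2
  have hΦd := (ContDiffOn.hasFDerivAt_of_isOpen hΦ hB (hcomp x hx).1).differentiableAt
  have h := mfderiv_comp x (mdifferentiableAt_iff_differentiableAt.2 hΦd)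
    ((mdifferentiable_of_mem_atlas hφ₀).mdifferentiableAt (hsub hx))
  rw [← hev.mfderiv_eq, mfderiv_eq_fderiv] at h
  exact congrArg (fun L => L w) h

/-- In projective coordinates the Christoffel symbols are of the form
`Γ(u, v) = λ(u) v + λ(v) u`. -/
theorem IsChristoffel.eq_of_projective_coordinates (hΓ₀ : IsChristoffel cov φ₀ Γ₀)
    (hΓ : IsChristoffel cov φ Γ) (hφ₀ : φ₀ ∈ IsManifold.maximalAtlas 𝓘(ℝ, Rn n) ∞ M)
    (hφ : φ ∈ IsManifold.maximalAtlas 𝓘(ℝ, Rn n) ∞ M)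
    {Φ : Rn n → Rn n} {lam : Rn n → Rn n →L[ℝ] ℝ} {B : Set (Rn n)} (hB : IsOpen B)
    (hΦ : ContDiffOn ℝ ∞ Φ B) (hΦ2 : ∀ y ∈ B, ∀ u v, fderiv ℝ (fderiv ℝ Φ) y u v =
      fderiv ℝ Φ y (Γ₀ y u v) - lam y u • fderiv ℝ Φ y v - lam y v • fderiv ℝ Φ y u)
    (hsub : φ.source ⊆ φ₀.source)
    (hcomp : ∀ x ∈ φ.source, φ₀ x ∈ B ∧ φ x = Φ (φ₀ x)) :
    ∃ lam' : Rn n → Rn n →L[ℝ] ℝ, ∀ y ∈ φ.target, ∀ u v,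
      Γ y u v = lam' y u • v + lam' y v • u := by
  refine ⟨fun y => (lam (φ₀ (φ.symm y))).comp
    ((chartDeriv φ₀ (φ.symm y)).comp (chartInv φ (φ.symm y))), fun y hy u v => ?_⟩
  have hx := φ.map_target hy
  have hx₀ := hsub hx
  have hz := φ₀.map_source hx₀
  have hzB := (hcomp _ hx).1
  set x := φ.symm y with hxdef
  set z := φ₀ x with hzdef
  have hD := @chartDeriv_comp n M _ _ _ φ₀ φ hφ₀ Φ B hB hΦ hsub hcomp
  set a := chartDeriv φ₀ x (chartInv φ x u) with ha
  set b := inChart φ₀ (constField φ v) with hb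
  have hVs : SmoothFieldAt (constField φ v) x := smoothFieldAt_constField hφ hx v
  have hVs' : SmoothFieldAt (constField φ v) (φ₀.symm z) := by rwa [hzdef, φ₀.left_inv hx₀]
  have hbd : DifferentiableAt ℝ b z :=
    (SmoothFieldAt.contDiffAt_inChart hφ₀ hz hVs').differentiableAt (by simp)
  have hbz : b z = chartDeriv φ₀ x (chartInv φ x v) := inChart_apply hx₀ _
  -- The `φ`-constant field has components `b` in `φ₀` with `dΦ(b) = v`. Differentiating gives
  -- `dΦ(∂b) = -∂²Φ(a, b)`, and the equation for `∂²Φ` then cancels `Γ₀`.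
  have hconst : (fun z' => fderiv ℝ Φ z' (b z')) =ᶠ[𝓝 z] fun _ => v := by
    have ho : IsOpen (φ₀.target ∩ φ₀.symm ⁻¹' φ.source) :=
      φ₀.symm.isOpen_inter_preimage φ.open_source
    filter_upwards [ho.mem_nhds ⟨hz, by rw [mem_preimage, hzdef, φ₀.left_inv hx₀]; exact hx⟩]
      with z' hz'
    have h1 := hD hz'.2 (constField φ v (φ₀.symm z'))
    rw [φ₀.right_inv hz'.1] at h1
    exact h1.symm.trans (chartDeriv_chartInv hφ hz'.2 v)
  have hfd := ContDiffOn.hasFDerivAt_of_isOpen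
    (hΦ.fderiv_of_isOpen (m := ∞) hB le_rfl) hB hzB
  have hder := (hfd.clm_apply hbd.hasFDerivAt).fderiv
  rw [hconst.fderiv_eq, fderiv_fun_const] at hder
  have hder' : 0 = fderiv ℝ Φ z (fderiv ℝ b z a) + fderiv ℝ (fderiv ℝ Φ) z a (b z) :=
    congrArg (fun L => L a) hder
  have hnab : inChart φ₀ (nabla cov (constField φ u) (constField φ v)) z =
      fderiv ℝ b z a + Γ₀ z a (b z) := by
    rw [hΓ₀.inChart_nabla hz _ hVs']
    have : inChart φ₀ (constField φ u) z = a := inChart_apply hx₀ _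
    rw [this]
  rw [inChart_apply hx₀] at hnab
  rw [← hΓ.inChart_nabla_constField hφ hy]
  change chartDeriv φ x (nabla cov (constField φ u) (constField φ v) x) = _
  rw [hD hx, hnab, map_add]
  have e1 : fderiv ℝ Φ z a = u := by
    rw [ha, ← hD hx]; exact chartDeriv_chartInv hφ hx u
  have e2 : fderiv ℝ Φ z (b z) = v := by
    rw [hbz, ← hD hx]; exact chartDeriv_chartInv hφ hx v
  have h2 := hΦ2 z hzB a (b z)
  rw [e1, e2] at h2
  change _ = lam z a • v + lam z (chartDeriv φ₀ x (chartInv φ x v)) • u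
  rw [← hbz]
  linear_combination (norm := module) -h2 - hder'

end ChangeOfChart

/-! ### Volume and Killing–Yano equations in projective coordinates -/

section Projective

variable {n p : ℕ}

theorem form_stdVec_ne_zero {T : Rn n [⋀^Fin n]→L[ℝ] ℝ} (hT : T ≠ 0) :
    T (fun j => stdVec j) ≠ 0 := by
  have h := (AlternatingMap.map_basis_ne_zero_iff (EuclideanSpace.basisFun (Fin n) ℝ).toBasis
    T.toAlternatingMap).2 fun h => hT (ContinuousAlternatingMap.toAlternatingMap_injective h)
  have e : ⇑(EuclideanSpace.basisFun (Fin n) ℝ).toBasis = fun j => stdVec j := by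
    funext j; simp
  rwa [e] at h

theorem form_eq_zero_of_lt (hp : n < p) (T : Rn n [⋀^Fin p]→L[ℝ] ℝ) : T = 0 := by
  refine form_ext fun i => ?_
  have h : ¬ Function.Injective i := fun hi => by
    have := Fintype.card_le_of_injective i hi
    simp at this
    omega
  exact T.toAlternatingMap.map_eq_zero_of_not_injective _ fun h' =>
    h (Function.Injective.of_comp (f := (stdVec : Fin n → Rn n)) h')

/-- The difference of the two sides is `λ ∧ T`, a form of degree `n + 1` on `ℝⁿ`. -/
theorem sum_map_update_trace (lam : Rn n →L[ℝ] ℝ) (T : Rn n [⋀^Fin n]→L[ℝ] ℝ) (u : Rn n)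
    (v : Fin n → Rn n) : ∑ j, lam (v j) * T (Function.update v j u) = lam u * T v := by
  obtain ⟨κ, hκ⟩ := exists_wedge lam T
  have h := hκ u v
  rw [form_eq_zero_of_lt (Nat.lt_succ_self n) κ] at h
  exact (sub_eq_zero.1 h.symm).symm

theorem sum_map_update_projective (lam : Rn n →L[ℝ] ℝ) (T : Rn n [⋀^Fin p]→L[ℝ] ℝ) (u : Rn n)
    (v : Fin p → Rn n) :
    ∑ j, T (Function.update v j (lam u • v j + lam (v j) • u)) =
      p * (lam u * T v) + ∑ j, lam (v j) * T (Function.update v j u) := by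
  simp only [ContinuousAlternatingMap.map_update_add, ContinuousAlternatingMap.map_update_smul,
    Function.update_eq_self, Finset.sum_add_distrib, smul_eq_mul, Finset.sum_const,
    Finset.card_univ, Fintype.card_fin, nsmul_eq_mul]

theorem cons_stdVec (k : Fin n) (i : Fin p → Fin n) :
    (fun j => stdVec ((Fin.cons k i : Fin (p + 1) → Fin n) j)) =
      (Fin.cons (stdVec k) (fun j => stdVec (i j)) : Fin (p + 1) → Rn n) := by
  funext j
  refine Fin.cases ?_ (fun j => ?_) j <;> simp

variable {M : Type*} [TopologicalSpace M] [ChartedSpace (Rn n) M] [IsManifold 𝓘(ℝ, Rn n) ∞ M]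
variable {φ : OpenPartialHomeomorph M (Rn n)}
  {cov : Connection n M} {Γ : Rn n → Rn n →L[ℝ] Rn n →L[ℝ] Rn n} {lam : Rn n → Rn n →L[ℝ] ℝ}

theorem IsChristoffel.nablaForm_projective (hΓ : IsChristoffel cov φ Γ)
    (hφ : φ ∈ IsManifold.maximalAtlas 𝓘(ℝ, Rn n) ∞ M)
    (hlam : ∀ y ∈ φ.target, ∀ u v, Γ y u v = lam y u • v + lam y v • u)
    {θ : FormField n M p} (hθ : SmoothFormOn θ φ.source) {x : M} (hx : x ∈ φ.source)
    (X : VField n M) {Y : Fin p → VField n M} (hY : ∀ j, SmoothFieldAt (Y j) x) :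
    nablaForm cov θ X Y x =
      fderiv ℝ (formInChart φ θ) (φ x) (chartDeriv φ x (X x))
        (fun j => chartDeriv φ x (Y j x)) -
      (p * (lam (φ x) (chartDeriv φ x (X x)) *
          formInChart φ θ (φ x) (fun j => chartDeriv φ x (Y j x))) +
        ∑ j, lam (φ x) (chartDeriv φ x (Y j x)) * formInChart φ θ (φ x)
          (Function.update (fun j => chartDeriv φ x (Y j x)) j (chartDeriv φ x (X x)))) := by
  rw [hΓ.nablaForm_eq hφ hθ hx X hY, ← sum_map_update_projective]
  simp only [hlam _ (φ.map_source hx)]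

/-- The Killing-Yano equation in projective coordinates. -/
theorem IsChristoffel.killingYano_iff (hΓ : IsChristoffel cov φ Γ)
    (hφ : φ ∈ IsManifold.maximalAtlas 𝓘(ℝ, Rn n) ∞ M)
    (hlam : ∀ y ∈ φ.target, ∀ u v, Γ y u v = lam y u • v + lam y v • u)
    {θ : FormField n M p} (hθ : SmoothFormOn θ φ.source) {x : M} (hx : x ∈ φ.source) :
    (∃ α : Tangent n x [⋀^Fin (p + 1)]→L[ℝ] ℝ, ∀ Y : Fin (p + 1) → VField n M,
      (∀ i, SmoothFieldAt (Y i) x) →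
        nablaForm cov θ (Y 0) (fun i => Y i.succ) x = α (fun i => Y i x)) ↔
    ∃ β : Rn n [⋀^Fin (p + 1)]→L[ℝ] ℝ, ∀ (u : Rn n) (v : Fin p → Rn n),
      fderiv ℝ (formInChart φ θ) (φ x) u v -
        (p + 1) * (lam (φ x) u * formInChart φ θ (φ x) v) = β (Fin.cons u v) := by
  -- `κ = λ ∧ θ` is skew, so it can be absorbed into `α` or `β`; trading the sum over slots for `κ`
  -- raises the coefficient of `λ ⊗ θ` from `p` to `p + 1`.
  obtain ⟨κ, hκ⟩ := exists_wedge (lam (φ x)) (formInChart φ θ (φ x))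
  constructor
  · rintro ⟨α, hα⟩
    refine ⟨α.compContinuousLinearMap (chartInv φ x) - κ, fun u v => ?_⟩
    have h := hα (fun i => constField φ ((Fin.cons u v : Fin (p + 1) → Rn n) i))
      fun i => smoothFieldAt_constField hφ hx _
    rw [hΓ.nablaForm_projective hφ hlam hθ hx _ fun j => smoothFieldAt_constField hφ hx _] at h
    simp only [constField, chartDeriv_chartInv hφ hx, Fin.cons_zero, Fin.cons_succ] at h
    have h1 : α.compContinuousLinearMap (chartInv φ x) (Fin.cons u v) =
      α (fun i => chartInv φ x ((Fin.cons u v : Fin (p + 1) → Rn n) i)) := rfl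
    rw [ContinuousAlternatingMap.sub_apply, hκ, h1, ← h]
    ring
  · rintro ⟨β, hβ⟩
    refine ⟨(β + κ).compContinuousLinearMap (chartDeriv φ x), fun Y hY => ?_⟩
    rw [hΓ.nablaForm_projective hφ hlam hθ hx _ fun j => hY _]
    have h1 : (β + κ).compContinuousLinearMap (chartDeriv φ x) (fun i => Y i x) =
        (β + κ) (Fin.cons (chartDeriv φ x (Y 0 x)) fun i => chartDeriv φ x (Y i.succ x)) := by
      change (β + κ) (fun i => chartDeriv φ x (Y i x)) = _
      congr 1
      funext i
      refine Fin.cases ?_ (fun j => ?_) i <;> simp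
    rw [h1, ContinuousAlternatingMap.add_apply, hκ, ← hβ]
    ring

/-- In projective coordinates the component of a parallel volume form is, up to a constant power,
a potential of the one-form `λ`. -/
theorem IsChristoffel.hasFDerivAt_log_volume (hΓ : IsChristoffel cov φ Γ)
    (hφ : φ ∈ IsManifold.maximalAtlas 𝓘(ℝ, Rn n) ∞ M)
    (hlam : ∀ y ∈ φ.target, ∀ u v, Γ y u v = lam y u • v + lam y v • u)
    {η : FormField n M n} (hη : SmoothFormOn η φ.source)
    (hpar : ∀ x ∈ φ.source, ∀ (X : VField n M) (Y : Fin n → VField n M), SmoothFieldAt X x →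
      (∀ i, SmoothFieldAt (Y i) x) → nablaForm cov η X Y x = 0)
    (hpos : ∀ y ∈ φ.target, 0 < formInChart φ η y (fun j => stdVec j)) {y : Rn n}
    (hy : y ∈ φ.target) :
    HasFDerivAt (fun y => ((n : ℝ) + 1)⁻¹ * Real.log (formInChart φ η y (fun j => stdVec j)))
      (lam y) y := by
  have hT := ContDiffOn.hasFDerivAt_of_isOpen (contDiffOn_formInChart hφ hη) φ.open_target hy
  have hc := (hT.continuousAlternatingMap_apply_const (fun j => stdVec j)).log (hpos y hy).ne'
  refine (hc.const_mul ((n : ℝ) + 1)⁻¹).congr_fderiv ?_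
  ext u
  have hx := φ.map_target hy
  have h := hpar _ hx (constField φ u) (fun j => constField φ (stdVec j))
    (smoothFieldAt_constField hφ hx u) fun j => smoothFieldAt_constField hφ hx _
  rw [hΓ.nablaForm_projective hφ hlam hη hx _ fun j => smoothFieldAt_constField hφ hx _] at h
  simp only [constField, chartDeriv_chartInv hφ hx, sum_map_update_trace, φ.right_inv hy] at h
  have h1 : (n : ℝ) + 1 ≠ 0 := by positivity
  have h2 := (hpos y hy).ne'
  -- `n` copies of `λ(u)` come from the slots and one more from `sum_map_update_trace`.
  have h3 : fderiv ℝ (formInChart φ η) y u (fun j => stdVec j) =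
      ((n : ℝ) + 1) * (lam y u * formInChart φ η y fun j => stdVec j) := by linarith
  simp only [_root_.smul_apply, smul_eq_mul, ContinuousLinearMap.flipAlternating_apply_apply, h3]
  field_simp

end Projective

/-! ### The projective chart around a point -/

section ProjectiveChart

variable {n : ℕ} {M : Type*} [TopologicalSpace M] [ChartedSpace (Rn n) M]
  [IsManifold 𝓘(ℝ, Rn n) ∞ M]

/-- Every top-degree form that does not vanish is positive on a reordering of the standard basis. -/
theorem exists_reordering_pos (hn : 1 < n) {T : Rn n [⋀^Fin n]→L[ℝ] ℝ} (hT : T ≠ 0) :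
    ∃ L : Rn n ≃L[ℝ] Rn n, 0 < T (fun j => L.symm (stdVec j)) := by
  rcases (form_stdVec_ne_zero hT).lt_or_gt with h | h
  · let σ : Equiv.Perm (Fin n) := Equiv.swap ⟨0, by omega⟩ ⟨1, hn⟩
    let L : Rn n ≃L[ℝ] Rn n :=
      (LinearIsometryEquiv.piLpCongrLeft 2 ℝ ℝ σ).symm.toContinuousLinearEquiv
    refine ⟨L, ?_⟩
    have e : (fun j => L.symm (stdVec j)) = (fun j => stdVec j) ∘ σ := by
      funext j; exact EuclideanSpace.piLpCongrLeft_single σ j 1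
    have hswap := T.toAlternatingMap.map_swap (fun j => stdVec j)
      (i := (⟨0, by omega⟩ : Fin n)) (j := ⟨1, hn⟩) (by simp [Fin.ext_iff])
    rw [e]
    exact lt_of_lt_of_eq (neg_pos.2 h) hswap.symm
  · exact ⟨ContinuousLinearEquiv.refl ℝ _, h⟩

/-- Around every point of an equiprojective equiaffine manifold there are projective coordinates,
with a ball as their range, in which the volume element has a positive component. -/
theorem exists_projective_chart [T2Space M] (hn : 2 < n) {η : FormField n M n}
    {cov : Connection n M} (hea : IsEquiaffine η cov) (hep : IsEquiprojective cov) (m : M) :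
    ∃ φ ∈ IsManifold.maximalAtlas 𝓘(ℝ, Rn n) ∞ M, m ∈ φ.source ∧ IsPreconnected φ.target ∧
      (∀ y ∈ φ.target, 0 < formInChart φ η y (fun j => stdVec j)) ∧
      ∃ (Γ : Rn n → Rn n →L[ℝ] Rn n →L[ℝ] Rn n) (lam : Rn n → Rn n →L[ℝ] ℝ),
        IsChristoffel cov φ Γ ∧ ∀ y ∈ φ.target, ∀ u v, Γ y u v = lam y u • v + lam y v • u := by
  have hφ₀ := IsManifold.chart_mem_maximalAtlas (I := 𝓘(ℝ, Rn n)) (n := ∞) m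
  have hm₀ := mem_chart_source (Rn n) m
  set φ₀ := chartAt (Rn n) m
  obtain ⟨Γ₀, hΓ₀⟩ := exists_isChristoffel cov hφ₀
  obtain ⟨P, hP⟩ := exists_isProjectivelyFlat (by omega) hΓ₀ hea.smooth_connection
    hea.torsion_free hep hφ₀
  have hη0 : formInChart φ₀ η (φ₀ m) ≠ 0 := by
    intro h
    refine hea.volume_ne_zero m ?_
    ext Y
    rw [form_apply_eq hφ₀ hm₀, h]; rfl
  -- The freedom in the initial differential of `Φ` fixes the orientation, so that the component of
  -- `η` is positive at `m`.
  obtain ⟨L, hL⟩ := exists_reordering_pos (by omega) hη0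
  obtain ⟨Φ, lam, hΦL, r, hr, -, hΦ, hΦ2⟩ :=
    hP.exists_projective_coordinates (hasTransversals_rn hn) (φ₀.map_source hm₀) L
  obtain ⟨φ₁, hφ₁, hm₁, hsub₁, hcomp₁⟩ :=
    exists_chart_comp hφ₀ hm₀ isOpen_ball (mem_ball_self hr) hΦ hΦL
  have hη₁ : SmoothFormOn η φ₁.source := fun x _ => hea.smooth_volume x (mem_univ x)
  have hpos : 0 < formInChart φ₁ η (φ₁ m) (fun j => stdVec j) := by
    refine lt_of_lt_of_eq hL ?_
    have h := form_apply_eq hφ₀ hm₀ η (fun j => constField φ₁ (stdVec j) m)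
    rw [formInChart_apply φ₁, φ₁.left_inv hm₁, h]
    congr 1
    funext j
    have h2 := chartDeriv_comp hφ₀ isOpen_ball hΦ hsub₁ hcomp₁ hm₁ (constField φ₁ (stdVec j) m)
    rw [hΦL] at h2
    have h3 : chartDeriv φ₁ m (constField φ₁ (stdVec j) m) = stdVec j :=
      chartDeriv_chartInv hφ₁ hm₁ _
    rw [h3] at h2
    exact (L.eq_symm_apply.2 h2.symm).symm
  have hcont : ContinuousOn (fun y => formInChart φ₁ η y (fun j => stdVec j)) φ₁.target :=
    fun y hy => ((ContDiffOn.hasFDerivAt_of_isOpen (contDiffOn_formInChart hφ₁ hη₁)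
      φ₁.open_target hy).continuousAlternatingMap_apply_const
        (fun j => stdVec j)).continuousAt.continuousWithinAt
  have hnhds := (hcont.isOpen_inter_preimage φ₁.open_target isOpen_Ioi).mem_nhds
    (x := φ₁ m) ⟨φ₁.map_source hm₁, hpos⟩
  -- A ball in the coordinates keeps this positivity and is convex, hence preconnected, as the
  -- integration of the Killing–Yano equation requires.
  obtain ⟨ε, hε, hball⟩ := Metric.mem_nhds_iff.1 hnhds
  obtain ⟨φ, hφ, hφc, hφt, hφform, hφsub, hφmem⟩ := exists_restrict_target hφ₁
    (isOpen_ball (x := φ₁ m) (ε := ε)) fun y hy => (hball hy).1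
  obtain ⟨Γ, hΓ⟩ := exists_isChristoffel cov hφ
  obtain ⟨lam', hlam'⟩ := hΓ₀.eq_of_projective_coordinates hΓ hφ₀ hφ isOpen_ball hΦ hΦ2
    (hφsub.trans hsub₁) fun x hx => ⟨(hcomp₁ x (hφsub hx)).1, hφc ▸ (hcomp₁ x (hφsub hx)).2⟩
  refine ⟨φ, hφ, hφmem m hm₁ (mem_ball_self hε), hφt ▸ (convex_ball _ _).isPreconnected,
    fun y hy => ?_, Γ, lam', hΓ, hlam'⟩
  rw [hφform]
  exact (hball (hφt ▸ hy)).2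

end ProjectiveChart

/-! ### Integration of the Killing–Yano equation -/

section Affine

variable {n p : ℕ}

theorem contDiffOn_form_apply {T : Rn n → Rn n [⋀^Fin p]→L[ℝ] ℝ} {Ω : Set (Rn n)}
    (hT : ContDiffOn ℝ ∞ T Ω) (v : Fin p → Rn n) : ContDiffOn ℝ ∞ (fun y => T y v) Ω :=
  (ContinuousAlternatingMap.apply ℝ (Rn n) ℝ v).contDiff.comp_contDiffOn hT

/-- The solutions of the Killing-Yano equation in projective coordinates. -/
theorem exists_affine_of_killingYano (hp : 1 ≤ p) {Ω : Set (Rn n)} (hΩ : IsOpen Ω)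
    (hc : IsPreconnected Ω) {y₀ : Rn n} (hy₀ : y₀ ∈ Ω) {ψ : Rn n → ℝ}
    {lam : Rn n → Rn n →L[ℝ] ℝ} (hψ : ContDiffOn ℝ ∞ ψ Ω)
    (hψd : ∀ y ∈ Ω, HasFDerivAt ψ (lam y) y) {T : Rn n → Rn n [⋀^Fin p]→L[ℝ] ℝ}
    (hT : ContDiffOn ℝ ∞ T Ω)
    (hKY : ∀ y ∈ Ω, ∃ β : Rn n [⋀^Fin (p + 1)]→L[ℝ] ℝ, ∀ (u : Rn n) (v : Fin p → Rn n),
      fderiv ℝ T y u v - (p + 1) * (lam y u * T y v) = β (Fin.cons u v)) :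
    ∃ (a : Rn n [⋀^Fin (p + 1)]→L[ℝ] ℝ) (b : Rn n [⋀^Fin p]→L[ℝ] ℝ), ∀ y ∈ Ω, ∀ v,
      T y v = Real.exp (((p : ℝ) + 1) * ψ y) * (a (Fin.cons y v) + b v) := by
  -- The integrating factor absorbs the term `(p + 1) λ ⊗ T`, since `λ = dψ`.
  set τ : Rn n → Rn n [⋀^Fin p]→L[ℝ] ℝ := fun y => Real.exp (-(((p : ℝ) + 1) * ψ y)) • T y with hτ
  have hτs : ContDiffOn ℝ ∞ τ Ω := ((contDiffOn_const.mul hψ).neg.exp).smul hT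
  have hτd : ∀ y ∈ Ω, ∃ β : Rn n [⋀^Fin (p + 1)]→L[ℝ] ℝ, ∀ (u : Rn n) (v : Fin p → Rn n),
      fderiv ℝ τ y u v = β (Fin.cons u v) := by
    intro y hy
    obtain ⟨β, hβ⟩ := hKY y hy
    refine ⟨Real.exp (-(((p : ℝ) + 1) * ψ y)) • β, fun u v => ?_⟩
    have hd : HasFDerivAt τ _ y := (((hψd y hy).const_mul ((p : ℝ) + 1)).neg.exp).smul
      (ContDiffOn.hasFDerivAt_of_isOpen hT hΩ hy)
    have h : fderiv ℝ τ y u v = Real.exp (-(((p : ℝ) + 1) * ψ y)) * fderiv ℝ T y u v +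
        (Real.exp (-(((p : ℝ) + 1) * ψ y)) * (-(((p : ℝ) + 1) * lam y u))) * T y v := by
      rw [hd.fderiv]; rfl
    rw [h, ContinuousAlternatingMap.smul_apply, ← hβ, smul_eq_mul]
    ring
  obtain ⟨a, ha⟩ := hτd y₀ hy₀
  -- `b` is the value at the origin of the affine extension of `τ`; the origin need not lie in `Ω`.
  refine ⟨a, τ y₀ - fderiv ℝ τ y₀ y₀, fun y hy v => ?_⟩
  have h := exists_affine_of_fderiv_skew hp hΩ hc hτs hτd hy₀ hy
  have h1 : T y v = Real.exp (((p : ℝ) + 1) * ψ y) * τ y v := by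
    change _ = _ * (Real.exp (-(((p : ℝ) + 1) * ψ y)) * T y v)
    rw [← mul_assoc, ← Real.exp_add, add_neg_cancel, Real.exp_zero, one_mul]
  rw [h1, h, ← ha, map_sub]
  congr 1
  change τ y₀ v + (fderiv ℝ τ y₀ y v - fderiv ℝ τ y₀ y₀ v) =
    fderiv ℝ τ y₀ y v + (τ y₀ v - fderiv ℝ τ y₀ y₀ v)
  ring

/-- Differentiating the exponential produces exactly the subtracted term; differentiating the affine
factor leaves the skew form `a`. -/
theorem killingYano_of_affine {Ω : Set (Rn n)} {ψ : Rn n → ℝ} {lam : Rn n → Rn n →L[ℝ] ℝ}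
    (hψd : ∀ y ∈ Ω, HasFDerivAt ψ (lam y) y)
    (a : Rn n [⋀^Fin (p + 1)]→L[ℝ] ℝ) (b : Rn n [⋀^Fin p]→L[ℝ] ℝ) {y : Rn n} (hy : y ∈ Ω)
    (u : Rn n) (v : Fin p → Rn n) :
    fderiv ℝ (fun y => Real.exp (((p : ℝ) + 1) * ψ y) • (a.curryLeft y + b)) y u v -
      (p + 1) * (lam y u * (Real.exp (((p : ℝ) + 1) * ψ y) • (a.curryLeft y + b)) v) =
    (Real.exp (((p : ℝ) + 1) * ψ y) • a) (Fin.cons u v) := by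
  have hd : HasFDerivAt (fun y => Real.exp (((p : ℝ) + 1) * ψ y) • (a.curryLeft y + b)) _ y :=
    (((hψd y hy).const_mul ((p : ℝ) + 1)).exp).smul
    ((a.curryLeft.hasFDerivAt (x := y)).add_const b)
  have h : fderiv ℝ (fun y => Real.exp (((p : ℝ) + 1) * ψ y) • (a.curryLeft y + b)) y u v =
      Real.exp (((p : ℝ) + 1) * ψ y) * a (Fin.cons u v) +
        (Real.exp (((p : ℝ) + 1) * ψ y) * (((p : ℝ) + 1) * lam y u)) *
          (a (Fin.cons y v) + b v) := by
    rw [hd.fderiv]; rfl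
  rw [h]
  change _ - _ * (_ * (Real.exp (((p : ℝ) + 1) * ψ y) * (a (Fin.cons y v) + b v))) =
    Real.exp (((p : ℝ) + 1) * ψ y) * a (Fin.cons u v)
  ring

theorem map_cons_stdVec (a : Rn n [⋀^Fin (p + 1)]→L[ℝ] ℝ) (y : Rn n) (i : Fin p → Fin n) :
    a (Fin.cons y fun j => stdVec (i j)) =
      ∑ k, a (fun j => stdVec ((Fin.cons k i : Fin (p + 1) → Fin n) j)) * y k := by
  simp only [cons_stdVec]
  change a.curryLeft y _ = ∑ k, a.curryLeft (stdVec k) _ * y k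
  conv_lhs => rw [← sum_smul_stdVec y]
  simp only [map_sum, map_smul, ContinuousAlternatingMap.sum_apply,
    ContinuousAlternatingMap.smul_apply, smul_eq_mul, mul_comm]

end Affine

end Equiaffine

/-! ### The theorem -/

theorem theorem1 {n : ℕ} (hn : 2 < n) {M : Type*} [TopologicalSpace M] [T2Space M]
    [ChartedSpace (Rn n) M] [IsManifold 𝓘(ℝ, Rn n) ∞ M]
    (η : FormField n M n) (cov : Connection n M)
    (hequiaffine : IsEquiaffine η cov) (hequiprojective : IsEquiprojective cov) (m : M) :
    ∃ φ ∈ IsManifold.maximalAtlas 𝓘(ℝ, Rn n) ∞ M, m ∈ φ.source ∧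
      (∀ x ∈ φ.source, 0 < component φ η id x) ∧
      ∀ p : ℕ, 1 ≤ p → p ≤ n - 1 →
        (∀ θ : FormField n M p, IsKillingYanoOn cov θ φ.source →
          ∃ (A : (Fin (p + 1) → Fin n) → ℝ) (B : (Fin p → Fin n) → ℝ), IsSkew A ∧ IsSkew B ∧
            ∀ x ∈ φ.source, ∀ i : Fin p → Fin n,
              component φ θ i x = Real.exp (((p : ℝ) + 1) * psi φ η x) *
                (∑ i₀, A (Fin.cons i₀ i) * φ x i₀ + B i)) ∧
        (∀ (A : (Fin (p + 1) → Fin n) → ℝ) (B : (Fin p → Fin n) → ℝ), IsSkew A → IsSkew B →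
          ∃ θ : FormField n M p, IsKillingYanoOn cov θ φ.source ∧
            ∀ x ∈ φ.source, ∀ i : Fin p → Fin n,
              component φ θ i x = Real.exp (((p : ℝ) + 1) * psi φ η x) *
                (∑ i₀, A (Fin.cons i₀ i) * φ x i₀ + B i)) := by
  obtain ⟨φ, hφ, hm, hconn, hpos, Γ, lam, hΓ, hlam⟩ :=
    exists_projective_chart hn hequiaffine hequiprojective m
  have hη : SmoothFormOn η φ.source := fun x _ => hequiaffine.smooth_volume x (Set.mem_univ x)
  set ψ : Rn n → ℝ := fun y =>
    ((n : ℝ) + 1)⁻¹ * Real.log (formInChart φ η y (fun j => stdVec j)) with hψ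
  have hψd : ∀ y ∈ φ.target, HasFDerivAt ψ (lam y) y := fun y hy =>
    hΓ.hasFDerivAt_log_volume hφ hlam hη (fun x _ => hequiaffine.parallel x) hpos hy
  have hψs : ContDiffOn ℝ ∞ ψ φ.target := contDiffOn_const.mul
    ((contDiffOn_form_apply (contDiffOn_formInChart hφ hη) _).log fun y hy => (hpos y hy).ne')
  have hpsi : ∀ x ∈ φ.source, psi φ η x = ψ (φ x) := fun x hx => by
    rw [psi, component_eq hx]; rfl
  refine ⟨φ, hφ, hm, fun x hx => ?_, fun p hp hpn => ⟨fun θ hθ => ?_, fun A B hA hB => ?_⟩⟩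
  · rw [component_eq hx]; exact hpos _ (φ.map_source hx)
  · obtain ⟨a, b, hab⟩ := exists_affine_of_killingYano hp φ.open_target hconn
      (φ.map_source hm) hψs hψd (contDiffOn_formInChart hφ hθ.1) fun y hy => by
        have h := (hΓ.killingYano_iff hφ hlam hθ.1 (φ.map_target hy)).1
          (hθ.2 _ (φ.map_target hy))
        rwa [φ.right_inv hy] at h
    refine ⟨_, _, isSkew_components a, isSkew_components b, fun x hx i => ?_⟩
    rw [component_eq hx, hab _ (φ.map_source hx), hpsi x hx, map_cons_stdVec]
  · obtain ⟨a, ha⟩ := exists_form_of_isSkew hA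
    obtain ⟨b, hb⟩ := exists_form_of_isSkew hB
    -- `a.curryLeft y` inserts the position vector in the first slot of `a`, which matches the index
    -- `i₀` of `A`.
    set T : Rn n → Rn n [⋀^Fin p]→L[ℝ] ℝ := fun y =>
      Real.exp (((p : ℝ) + 1) * ψ y) • (a.curryLeft y + b) with hT
    have hTs : ContDiffOn ℝ ∞ T φ.target :=
      ((contDiffOn_const.mul hψs).exp).smul (a.curryLeft.contDiff.contDiffOn.add contDiffOn_const)
    have hθs := smoothFormOn_formOfChart hφ hTs
    refine ⟨formOfChart φ T, ⟨hθs, fun x hx => ?_⟩, fun x hx i => ?_⟩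
    · refine (hΓ.killingYano_iff hφ hlam hθs hx).2
        ⟨Real.exp (((p : ℝ) + 1) * ψ (φ x)) • a, fun u v => ?_⟩
      have hy := φ.map_source hx
      have hev : formInChart φ (formOfChart φ T) =ᶠ[nhds (φ x)] T := by
        filter_upwards [φ.open_target.mem_nhds hy] with z hz
        exact formInChart_formOfChart hφ hz T
      rw [hev.fderiv_eq, formInChart_formOfChart hφ hy]
      exact killingYano_of_affine hψd a b hy u v
    · rw [component_eq hx, formInChart_formOfChart hφ (φ.map_source hx), hpsi x hx]
      change Real.exp _ * (a (Fin.cons (φ x) _) + b _) = _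
      rw [map_cons_stdVec, hb]
      simp only [ha]
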